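/- Let $N\ge 2$ and let $\Omega\subset\mathbb R^N$ be a bounded domain (non-empty, open, connected) with boundary of class $C^2$ (in particular, any bounded smooth domain). Put $\delta(x)=\operatorname{dist}(x,\partial\Omega)$ and, for $\rho>0$, $\Omega_\rho=\{x\in\Omega:\delta(x)<\rho\}$. For open $G\subset\Omega$ let $H^1_c(G)$ be the set of functions in $H^1(G)$ vanishing a.e. outside a compact subset of $G$. Let $C_H(\Omega)$ be the largest constant $c\ge 0$ such that $$\int_\Omega|\nabla v|^2\,dx\ \ge\ c\int_\Omega\frac{v^2}{\delta^2}\,dx\qquad\text{for all }v\in H^1_0(\Omega).$$ Let $\mu,p,s\in\mathbb R$ with $p>1$, and consider the equation $$-\Delta u-\frac{\mu}{\delta^2}u+\frac{u^p}{\delta^s}=0\quad\text{in }\Omega.\qquad(*)$$ A *sub-solution* of $(*)$ in $\Omega$ is a function $0\le u\in H^1_{loc}(\Omega)\cap C(\Omega)$ such that $$\int_\Omega\nabla u\cdot\nabla\varphi\,dx-\int_\Omega\frac{\mu}{\delta^2}u\varphi\,dx+\int_\Omega\frac{u^p}{\delta^s}\varphi\,dx\le 0\qquad\text{for all }0\le\varphi\in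 H^1_c(\Omega).$$ A *local sub-harmonic* (respectively *local super-harmonic*) is a function $h$ for which there is $\rho>0$ such that $h\in H^1_{loc}(\Omega_\rho)\cap C(\Omega_\rho)$ and $\int_{\Omega_\rho}\nabla h\cdot\nabla\varphi\,dx-\int_{\Omega_\rho}\frac{\mu}{\delta^2}h\varphi\,dx\le 0$ (respectively $\ge 0$) for all $0\le\varphi\in H^1_c(\Omega_\rho)$; a local super-harmonic is called positive if it is positive on such an $\Omega_\rho$. A local sub-harmonic $h$ is *large* if $\limsup_{x\to\partial\Omega}h(x)/H(x)>0$ for every positive local super-harmonic $H$, and *small* otherwise. An *S-subsolution* of $(*)$ in $\Omega$ is a sub-solution of $(*)$ in $\Omega$ that is a small local sub-harmonic. **Theorem.** If $\mu\le C_H(\Omega)$, $p>1$ and $s\in\mathbb R$, then $(*)$ has no nontrivial S-subsolution in $\Omega$; that is, every S-subsolution of $(*)$ in $\Omega$ vanishes identically. -/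

import Mathlib

open MeasureTheory Filter Topology
open scoped ContDiff

noncomputable section

namespace HardyNonlinear

/-- The Euclidean space `ℝ^N`. -/
abbrev Eucl (N : ℕ) : Type := EuclideanSpace ℝ (Fin N)

/-- The boundary of `Ω` is of class `C^k`: near each boundary point, `Ω` is a sublevel set
`{f < 0}` of a `C^k` function whose differential does not vanish. -/
def HasBoundaryOfClass {N : ℕ} (k : WithTop ℕ∞) (Ω : Set (Eucl N)) : Prop :=
  ∀ x ∈ frontier Ω, ∃ (U : Set (Eucl N)) (f : Eucl N → ℝ),
    IsOpen U ∧ x ∈ U ∧ ContDiffOn ℝ k f U ∧ (∀ y ∈ U, fderiv ℝ f y ≠ 0) ∧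
      Ω ∩ U = {y ∈ U | f y < 0}

/-- `δ(x) = dist(x, ∂Ω)`. -/
def bdryDist {N : ℕ} (Ω : Set (Eucl N)) (x : Eucl N) : ℝ :=
  Metric.infDist x (frontier Ω)

/-- The parallel set `Ω_ρ = {x ∈ Ω : δ(x) < ρ}`. -/
def parallelSet {N : ℕ} (Ω : Set (Eucl N)) (ρ : ℝ) : Set (Eucl N) :=
  {x ∈ Ω | bdryDist Ω x < ρ}

/-- The filter describing `x → ∂Ω` with `x ∈ Ω`. -/
def toBoundary {N : ℕ} (Ω : Set (Eucl N)) : Filter (Eucl N) :=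
  comap (bdryDist Ω) (𝓝 0) ⊓ 𝓟 Ω

/-- `φ ∈ C_c^∞(G)`. -/
def IsTestFunction {N : ℕ} (G : Set (Eucl N)) (φ : Eucl N → ℝ) : Prop :=
  ContDiff ℝ ∞ φ ∧ HasCompactSupport φ ∧ tsupport φ ⊆ G

/-- `g` is the weak (distributional) gradient of `u` in the open set `G`. -/
def HasWeakGradient {N : ℕ} (G : Set (Eucl N)) (u : Eucl N → ℝ) (g : Eucl N → Eucl N) : Prop :=
  LocallyIntegrableOn u G ∧ LocallyIntegrableOn g G ∧
    ∀ φ : Eucl N → ℝ, IsTestFunction G φ →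
      ∫ x in G, u x • gradient φ x = -∫ x in G, φ x • g x

/-- `u ∈ H^1_loc(G)` with weak gradient `g`. -/
def MemH1loc {N : ℕ} (G : Set (Eucl N)) (u : Eucl N → ℝ) (g : Eucl N → Eucl N) : Prop :=
  HasWeakGradient G u g ∧
    ∀ K : Set (Eucl N), IsCompact K → K ⊆ G →
      MemLp u 2 (volume.restrict K) ∧ MemLp g 2 (volume.restrict K)

/-- `u ∈ H^1(G)` with weak gradient `g`. -/
def MemH1 {N : ℕ} (G : Set (Eucl N)) (u : Eucl N → ℝ) (g : Eucl N → Eucl N) : Prop :=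
  HasWeakGradient G u g ∧ MemLp u 2 (volume.restrict G) ∧ MemLp g 2 (volume.restrict G)

/-- `u ∈ H^1_c(G)` with weak gradient `g`: an `H^1(G)` function which vanishes (almost everywhere)
outside a compact subset of `G`. -/
def MemH1c {N : ℕ} (G : Set (Eucl N)) (u : Eucl N → ℝ) (g : Eucl N → Eucl N) : Prop :=
  MemH1 G u g ∧
    ∃ K : Set (Eucl N), IsCompact K ∧ K ⊆ G ∧ ∀ᵐ x ∂(volume.restrict G), x ∉ K → u x = 0

/-- `u ∈ H^1_0(G)` with weak gradient `g`: the pair `(u, g)` is an `H^1(G)` limit of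
`C_c^∞(G)` functions and their gradients. -/
def MemH10 {N : ℕ} (G : Set (Eucl N)) (u : Eucl N → ℝ) (g : Eucl N → Eucl N) : Prop :=
  MemH1 G u g ∧
    ∃ φ : ℕ → Eucl N → ℝ, (∀ n, IsTestFunction G (φ n)) ∧
      Tendsto (fun n => eLpNorm (fun x => φ n x - u x) 2 (volume.restrict G)) atTop (𝓝 0) ∧
      Tendsto (fun n => eLpNorm (fun x => gradient (φ n) x - g x) 2 (volume.restrict G))
        atTop (𝓝 0)

/-- The Hardy constant `C_H(Ω)`: the largest `c ≥ 0` such that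
`c ∫_Ω u²/δ² ≤ ∫_Ω |∇u|²` for all `u ∈ H^1_0(Ω)`. The integrals take values in `[0, ∞]`. -/
def hardyConstant {N : ℕ} (Ω : Set (Eucl N)) : ℝ :=
  sSup {c : ℝ | 0 ≤ c ∧ ∀ (u : Eucl N → ℝ) (g : Eucl N → Eucl N), MemH10 Ω u g →
    ENNReal.ofReal c * ∫⁻ x in Ω, ENNReal.ofReal (u x ^ 2 / bdryDist Ω x ^ 2)
      ≤ ∫⁻ x in Ω, ENNReal.ofReal (‖g x‖ ^ 2)}

/-- The bilinear form `∫_G ∇u·∇φ - ∫_G (μ/δ²) u φ`, where `g = ∇u` and `ψ = ∇φ`, and where `δ` is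
the distance to `∂Ω`. -/
def linearForm {N : ℕ} (Ω : Set (Eucl N)) (μ : ℝ) (G : Set (Eucl N))
    (u : Eucl N → ℝ) (g : Eucl N → Eucl N) (φ : Eucl N → ℝ) (ψ : Eucl N → Eucl N) : ℝ :=
  (∫ x in G, inner ℝ (g x) (ψ x)) - ∫ x in G, μ / bdryDist Ω x ^ 2 * u x * φ x

/-- `h` is a sub-harmonic of `-Δ - μ/δ²` in `G ⊆ Ω`. -/
def IsSubharmonic {N : ℕ} (Ω : Set (Eucl N)) (μ : ℝ) (G : Set (Eucl N))
    (h : Eucl N → ℝ) : Prop :=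
  ContinuousOn h G ∧ ∃ g : Eucl N → Eucl N, MemH1loc G h g ∧
    ∀ (φ : Eucl N → ℝ) (ψ : Eucl N → Eucl N), MemH1c G φ ψ →
      (∀ᵐ x ∂(volume.restrict G), 0 ≤ φ x) → linearForm Ω μ G h g φ ψ ≤ 0

/-- `h` is a super-harmonic of `-Δ - μ/δ²` in `G ⊆ Ω`. -/
def IsSuperharmonic {N : ℕ} (Ω : Set (Eucl N)) (μ : ℝ) (G : Set (Eucl N))
    (h : Eucl N → ℝ) : Prop :=
  ContinuousOn h G ∧ ∃ g : Eucl N → Eucl N, MemH1loc G h g ∧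
    ∀ (φ : Eucl N → ℝ) (ψ : Eucl N → Eucl N), MemH1c G φ ψ →
      (∀ᵐ x ∂(volume.restrict G), 0 ≤ φ x) → 0 ≤ linearForm Ω μ G h g φ ψ

/-- `h` is a local sub-harmonic: a sub-harmonic in some parallel set `Ω_ρ`, `ρ > 0`. -/
def IsLocalSubharmonic {N : ℕ} (Ω : Set (Eucl N)) (μ : ℝ) (h : Eucl N → ℝ) : Prop :=
  ∃ ρ : ℝ, 0 < ρ ∧ IsSubharmonic Ω μ (parallelSet Ω ρ) h

/-- `h` is a positive local super-harmonic: a super-harmonic in, and positive on, some parallel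
set `Ω_ρ`, `ρ > 0`. -/
def IsPosLocalSuperharmonic {N : ℕ} (Ω : Set (Eucl N)) (μ : ℝ) (h : Eucl N → ℝ) : Prop :=
  ∃ ρ : ℝ, 0 < ρ ∧ IsSuperharmonic Ω μ (parallelSet Ω ρ) h ∧ ∀ x ∈ parallelSet Ω ρ, 0 < h x

/-- A local sub-harmonic `h` is large if `limsup_{x → ∂Ω} h/H > 0` for every positive local
super-harmonic `H`. The upper limit is taken in `[-∞, ∞]`. -/
def IsLarge {N : ℕ} (Ω : Set (Eucl N)) (μ : ℝ) (h : Eucl N → ℝ) : Prop :=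
  IsLocalSubharmonic Ω μ h ∧ ∀ H : Eucl N → ℝ, IsPosLocalSuperharmonic Ω μ H →
    0 < limsup (fun x => ((h x / H x : ℝ) : EReal)) (toBoundary Ω)

/-- A local sub-harmonic is small if it is not large. -/
def IsSmall {N : ℕ} (Ω : Set (Eucl N)) (μ : ℝ) (h : Eucl N → ℝ) : Prop :=
  IsLocalSubharmonic Ω μ h ∧ ¬ IsLarge Ω μ h

/-- `u ≥ 0` is a sub-solution of `-Δu - (μ/δ²) u + u^p/δ^s = 0` in `G ⊆ Ω`. -/
def IsSubsolution {N : ℕ} (Ω : Set (Eucl N)) (μ p s : ℝ) (G : Set (Eucl N))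
    (u : Eucl N → ℝ) : Prop :=
  ContinuousOn u G ∧ (∀ x ∈ G, 0 ≤ u x) ∧ ∃ g : Eucl N → Eucl N, MemH1loc G u g ∧
    ∀ (φ : Eucl N → ℝ) (ψ : Eucl N → Eucl N), MemH1c G φ ψ →
      (∀ᵐ x ∂(volume.restrict G), 0 ≤ φ x) →
        linearForm Ω μ G u g φ ψ + ∫ x in G, u x ^ p / bdryDist Ω x ^ s * φ x ≤ 0

/-- An S-subsolution in `Ω`: a sub-solution in `Ω` which is a small sub-harmonic. -/
def IsSSubsolution {N : ℕ} (Ω : Set (Eucl N)) (μ p s : ℝ) (u : Eucl N → ℝ) : Prop :=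
  IsSubsolution Ω μ p s Ω u ∧ IsSmall Ω μ u

end HardyNonlinear

end

/-! Smallness of u provides a positive local super-harmonic H with limsup u/H ≤ 0 at ∂Ω, so u < εH
near ∂Ω for every ε > 0. Let χ be a cutoff equal to 1 near ∂Ω and to 0 at the points of Ω where H is
not controlled. Then w = (u - εχH)⁺ has compact support in Ω and may be tested against the equation
for u. Write B(f, φ) = ∫ ∇f·∇φ - ∫ (μ/δ²) f φ. Since u = w + εχH on {w > 0}, B(u, w) = B(w, w) + ε
B(H, χw) + ε ∫ T, where T is the `commutator` of B with χ. The first term is nonnegative by the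
Hardy inequality, as μ ≤ C_H(Ω), and the second by super-harmonicity of H. Hence ∫ u^p δ^(-s) w ≤ -ε
∫ T. Now T lives where χ is not constant, in a compact shell inside Ω, and is bounded there by an
integrable function independent of ε ≤ 1. As ε → 0 the right side tends to 0, while a ball on which
u is bounded below by a positive constant would keep the left side away from 0. So u = 0.

The argument is carried by `exists_truncation`, `exists_commutator_bound`,
`integral_mul_truncation_le` and `eq_zero_of_isSubsolution`. The rest shows that w is admissible:
`IsCompactSobolev.posPart` gives its weak gradient, and `IsCompactSobolev.exists_approx`, by
mollification, places it in H^1_0, where the Hardy inequality holds. -/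

noncomputable section

namespace HardyNonlinear

/-! ### Mollification in L² and weak gradients. -/

section Mollification

open ContinuousLinearMap (lsmul)
open scoped Convolution

variable {N : ℕ} {F : Type*} [NormedAddCommGroup F] [NormedSpace ℝ F]

/-- Young's inequality for the convolution of an `L²` function with a probability density. -/
theorem eLpNorm_convolution_le {ρ : Eucl N → ℝ} (hρc : Continuous ρ)
    (hρ0 : ∀ x, 0 ≤ ρ x) (hρs : HasCompactSupport ρ) (hρ1 : ∫ x, ρ x = 1)
    {k : Eucl N → F} (hk : MemLp k 2 volume) :
    eLpNorm (ρ ⋆[lsmul ℝ ℝ, volume] k) 2 volume ≤ eLpNorm k 2 volume := by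
  -- A strongly measurable representative makes the double integrand jointly measurable, as Tonelli
  -- requires.
  obtain ⟨k', hk'm, hkk'⟩ := hk.1
  rw [convolution_congr (lsmul ℝ ℝ) (EventuallyEq.refl _ ρ) hkk', eLpNorm_congr_ae hkk']
  have hρint : Integrable ρ := hρc.integrable_of_hasCompactSupport hρs
  have hmass : ∫⁻ t, ‖ρ t‖ₑ = 1 := by
    have h := ofReal_integral_eq_lintegral_ofReal hρint (Eventually.of_forall hρ0)
    rw [hρ1, ENNReal.ofReal_one] at h
    rw [h]
    exact lintegral_congr fun t => Real.enorm_of_nonneg (hρ0 t)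
  have hm : Measurable fun t => ‖ρ t‖ₑ := hρc.measurable.enorm
  have key : ∀ x, ‖(ρ ⋆[lsmul ℝ ℝ, volume] k') x‖ₑ ^ (2 : ℝ)
      ≤ ∫⁻ t, ‖ρ t‖ₑ * ‖k' (x - t)‖ₑ ^ (2 : ℝ) := by
    intro x
    have hkm : Measurable fun t => ‖k' (x - t)‖ₑ :=
      (hk'm.enorm).comp (measurable_const.sub measurable_id)
    have h1 : ‖(ρ ⋆[lsmul ℝ ℝ, volume] k') x‖ₑ ≤ ∫⁻ t, ‖ρ t‖ₑ * ‖k' (x - t)‖ₑ := by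
      rw [convolution_lsmul]
      refine (enorm_integral_le_lintegral_enorm _).trans (lintegral_mono fun t => ?_)
      rw [enorm_smul]
    -- Cauchy–Schwarz against the constant 1 for the probability measure ρ dt, that is, Jensen's
    -- inequality for the square.
    have h2 := ENNReal.lintegral_mul_le_Lp_mul_Lq
      (volume.withDensity fun t => ‖ρ t‖ₑ) Real.HolderConjugate.two_two
      (f := fun _ => 1) (g := fun t => ‖k' (x - t)‖ₑ) aemeasurable_const hkm.aemeasurable
    simp only [Pi.mul_apply, one_mul, ENNReal.one_rpow] at h2
    rw [lintegral_withDensity_eq_lintegral_mul _ hm hkm,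
      lintegral_withDensity_eq_lintegral_mul _ hm measurable_const,
      lintegral_withDensity_eq_lintegral_mul _ hm (hkm.pow_const _)] at h2
    simp only [Pi.mul_apply, mul_one, hmass, ENNReal.one_rpow, one_mul] at h2
    calc _ ≤ ((∫⁻ t, ‖ρ t‖ₑ * ‖k' (x - t)‖ₑ ^ (2 : ℝ)) ^ ((1 : ℝ) / 2)) ^ (2 : ℝ) :=
          ENNReal.rpow_le_rpow (h1.trans h2) (by norm_num)
      _ = _ := by rw [← ENNReal.rpow_mul]; norm_num
  rw [eLpNorm_eq_lintegral_rpow_enorm_toReal (by norm_num) (by norm_num),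
    eLpNorm_eq_lintegral_rpow_enorm_toReal (by norm_num) (by norm_num)]
  refine ENNReal.rpow_le_rpow ?_ (by norm_num)
  simp only [ENNReal.toReal_ofNat]
  refine (lintegral_mono key).trans ?_
  rw [lintegral_lintegral_swap]
  · have : ∀ t : Eucl N, ∫⁻ x, ‖ρ t‖ₑ * ‖k' (x - t)‖ₑ ^ (2 : ℝ)
        = ‖ρ t‖ₑ * ∫⁻ x, ‖k' x‖ₑ ^ (2 : ℝ) := fun t => by
      rw [lintegral_const_mul' _ _ enorm_ne_top,
        lintegral_sub_right_eq_self (fun x => ‖k' x‖ₑ ^ (2 : ℝ)) t]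
    simp only [this]
    rw [lintegral_mul_const _ hm, hmass, one_mul]
  · refine Measurable.aemeasurable ?_
    exact (hm.comp measurable_snd).mul
      ((hk'm.enorm.comp (measurable_fst.sub measurable_snd)).pow_const _)

/-- Smooth approximations of the identity with supports in the balls of radius `r / (n + 1)`. -/
def mollifier (N : ℕ) {r : ℝ} (hr : 0 < r) (n : ℕ) : ContDiffBump (0 : Eucl N) where
  rIn := r / (n + 1) / 2
  rOut := r / (n + 1)
  rIn_pos := by positivity
  rIn_lt_rOut := half_lt_self (by positivity)

theorem mollifier_rOut_le {r : ℝ} (hr : 0 < r) (n : ℕ) : (mollifier N hr n).rOut ≤ r :=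
  div_le_self hr.le (by linarith [n.cast_nonneg (α := ℝ)])

theorem tendsto_mollifier_rOut {r : ℝ} (hr : 0 < r) :
    Tendsto (fun n => (mollifier N hr n).rOut) atTop (𝓝 0) :=
  tendsto_const_div_atTop_nhds_zero_nat r |>.comp (tendsto_add_atTop_nat 1) |>.congr fun n => by
    simp [mollifier]

/-- Mollification of `k` at scale `r / (n + 1)`. -/
def mollify {r : ℝ} (hr : 0 < r) (n : ℕ) (k : Eucl N → F) : Eucl N → F :=
  (mollifier N hr n).normed volume ⋆[lsmul ℝ ℝ, volume] k

/-- All mollifications are supported in one thickening of the support of k, of radius r independent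
of n. -/
theorem mollify_eq_zero [CompleteSpace F] {r : ℝ} (hr : 0 < r) (n : ℕ) {k : Eucl N → F}
    {x : Eucl N} (hx : x ∉ Metric.cthickening r (tsupport k)) : mollify hr n k x = 0 := by
  have h : ∀ y ∈ Metric.ball x r, k y = 0 := fun y hy => by
    by_contra h0
    exact hx (Metric.mem_cthickening_of_dist_le x y r _ (subset_tsupport _ h0)
      (by rw [dist_comm]; exact (Metric.mem_ball.1 hy).le))
  have hx0 : k x = 0 := h x (Metric.mem_ball_self hr)
  rw [mollify, ContDiffBump.normed_convolution_eq_right, hx0]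
  intro y hy
  rw [hx0, h y (Metric.ball_subset_ball (mollifier_rOut_le hr n) hy)]

/-- Uniform continuity makes the convergence uniform, and the differences vanish off a fixed compact
set, whose finite measure turns a sup bound into an L² bound. -/
theorem tendsto_eLpNorm_mollify_sub_of_continuous [CompleteSpace F] {r : ℝ} (hr : 0 < r)
    {h : Eucl N → F} (hc : Continuous h) (hs : HasCompactSupport h) :
    Tendsto (fun n => eLpNorm (mollify hr n h - h) 2 volume) atTop (𝓝 0) := by
  set K := Metric.cthickening r (tsupport h) with hK
  have hKc : IsCompact K := hs.cthickening
  have hKm : MeasurableSet K := hKc.measurableSet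
  have hvol : volume K ≠ ⊤ := hKc.measure_lt_top.ne
  have huc := hs.uniformContinuous_of_continuous hc
  have hzero : ∀ n, ∀ x ∉ K, (mollify hr n h - h) x = 0 := fun n x hx => by
    rw [Pi.sub_apply, mollify_eq_zero hr n hx, image_eq_zero_of_notMem_tsupport
      fun hx' => hx (Metric.self_subset_cthickening _ hx'), sub_zero]
  have hbound : ∀ ε : ℝ, 0 < ε → ∀ᶠ n in atTop, eLpNorm (mollify hr n h - h) 2 volume
      ≤ ENNReal.ofReal ε * volume K ^ (1 / (2 : ℝ)) := by
    intro ε hε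
    obtain ⟨d, hd, hd'⟩ := Metric.uniformContinuous_iff.1 huc ε hε
    filter_upwards [(tendsto_mollifier_rOut (N := N) hr).eventually (gt_mem_nhds hd)] with n hn
    have hle : ∀ x, ‖(mollify hr n h - h) x‖ ≤ ‖K.indicator (fun _ => ε) x‖ := by
      intro x
      by_cases hx : x ∈ K
      · rw [Set.indicator_of_mem hx, Pi.sub_apply, ← dist_eq_norm, Real.norm_of_nonneg hε.le]
        refine ContDiffBump.dist_normed_convolution_le hc.aestronglyMeasurable fun y hy => ?_
        exact (hd' ((Metric.mem_ball.1 hy).trans hn)).le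
      · rw [hzero n x hx]; simp
    refine (eLpNorm_mono hle).trans ?_
    rw [eLpNorm_indicator_const hKm (by norm_num) (by norm_num), Real.enorm_of_nonneg hε.le]
    simp
  have hC : volume K ^ (1 / (2 : ℝ)) ≠ ⊤ := ENNReal.rpow_ne_top_of_nonneg (by norm_num) hvol
  have hlim : Tendsto (fun ε : ℝ => ENNReal.ofReal ε * volume K ^ (1 / (2 : ℝ))) (𝓝[>] 0)
      (𝓝 0) := by
    have h0 : Tendsto (fun ε : ℝ => ENNReal.ofReal ε) (𝓝[>] 0) (𝓝 0) := by
      simpa using (ENNReal.continuous_ofReal.tendsto 0).mono_left nhdsWithin_le_nhds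
    simpa using ENNReal.Tendsto.mul_const h0 (Or.inr hC)
  rw [ENNReal.tendsto_nhds_zero]
  intro η hη
  obtain ⟨ε, hε1, hε2⟩ := ((ENNReal.tendsto_nhds_zero.1 hlim η hη).and self_mem_nhdsWithin).exists
  filter_upwards [hbound ε hε2] with n hn using hn.trans hε1

theorem mollify_sub {r : ℝ} (hr : 0 < r) (n : ℕ) {k h : Eucl N → F}
    (hk : LocallyIntegrable k) (hh : LocallyIntegrable h) :
    mollify hr n (k - h) = mollify hr n k - mollify hr n h := by
  funext x
  have hcs := (mollifier N hr n).hasCompactSupport_normed (μ := volume)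
  have hcc : Continuous ((mollifier N hr n).normed volume) := (mollifier N hr n).continuous_normed
  have hk' := HasCompactSupport.convolutionExists_left (lsmul ℝ ℝ) hcs hcc hk x
  have hh' := HasCompactSupport.convolutionExists_left (lsmul ℝ ℝ) hcs hcc hh x
  rw [Pi.sub_apply]
  simp only [mollify, convolution_lsmul, Pi.sub_apply, smul_sub]
  exact integral_sub hk' hh'

theorem eLpNorm_mollify_le {r : ℝ} (hr : 0 < r) (n : ℕ) {k : Eucl N → F}
    (hk : MemLp k 2 volume) : eLpNorm (mollify hr n k) 2 volume ≤ eLpNorm k 2 volume :=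
  eLpNorm_convolution_le (mollifier N hr n).continuous_normed (mollifier N hr n).nonneg_normed
    (mollifier N hr n).hasCompactSupport_normed (mollifier N hr n).integral_normed hk

theorem continuous_mollify {r : ℝ} (hr : 0 < r) (n : ℕ) {k : Eucl N → F}
    (hk : LocallyIntegrable k) : Continuous (mollify hr n k) :=
  (mollifier N hr n).hasCompactSupport_normed.continuous_convolution_left _
    (mollifier N hr n).continuous_normed hk

/-- Mollifications of an `L²` function converge to it in `L²`. -/
theorem tendsto_eLpNorm_mollify_sub [CompleteSpace F] {r : ℝ} (hr : 0 < r)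
    {k : Eucl N → F} (hk : MemLp k 2 volume) :
    Tendsto (fun n => eLpNorm (mollify hr n k - k) 2 volume) atTop (𝓝 0) := by
  rw [ENNReal.tendsto_nhds_zero]
  intro η hη
  have hη3 : η / 3 ≠ 0 := (ENNReal.div_pos hη.ne' (by norm_num)).ne'
  -- Continuous compactly supported functions are dense in L². The error k - h is counted twice,
  -- once mollified, which does not increase its norm, and the mollification error of h is the last
  -- third.
  obtain ⟨h, hs, hkh, hc, hh⟩ := hk.exists_hasCompactSupport_eLpNorm_sub_le (by norm_num) hη3
  have hkl : LocallyIntegrable k := hk.locallyIntegrable (by norm_num)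
  have hhl : LocallyIntegrable h := hh.locallyIntegrable (by norm_num)
  filter_upwards [ENNReal.tendsto_nhds_zero.1 (tendsto_eLpNorm_mollify_sub_of_continuous hr hc hs)
    (η / 3) (pos_iff_ne_zero.2 hη3)] with n hn
  have hdec : mollify hr n k - k = (mollify hr n (k - h) + (mollify hr n h - h)) - (k - h) := by
    rw [mollify_sub hr n hkl hhl]; abel
  have hm : ∀ {f : Eucl N → F}, LocallyIntegrable f →
      AEStronglyMeasurable (mollify hr n f) volume := fun hf =>
    (continuous_mollify hr n hf).aestronglyMeasurable
  have hm1 := hm (hkl.sub hhl)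
  have hm2 := (hm hhl).sub hh.1
  rw [hdec]
  calc _ ≤ eLpNorm (mollify hr n (k - h) + (mollify hr n h - h)) 2 volume
        + eLpNorm (k - h) 2 volume :=
        eLpNorm_sub_le (hm1.add hm2) (hk.1.sub hh.1) (by norm_num)
    _ ≤ (eLpNorm (mollify hr n (k - h)) 2 volume + eLpNorm (mollify hr n h - h) 2 volume)
        + eLpNorm (k - h) 2 volume := by gcongr; exact eLpNorm_add_le hm1 hm2 (by norm_num)
    _ ≤ (η / 3 + η / 3) + η / 3 := by
        gcongr
        exact (eLpNorm_mollify_le hr n (hk.sub hh)).trans hkh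
    _ = η := ENNReal.add_thirds η

/-- Mollification commutes with the weak gradient. -/
theorem hasGradientAt_mollify {r : ℝ} (hr : 0 < r) (n : ℕ) {f : Eucl N → ℝ}
    {g : Eucl N → Eucl N} (hfg : HasWeakGradient Set.univ f g) (x : Eucl N) :
    HasGradientAt (mollify hr n f) (mollify hr n g x) x := by
  obtain ⟨hf, hg, hw⟩ := hfg
  rw [locallyIntegrableOn_univ] at hf hg
  set ρ := (mollifier N hr n).normed volume with hρ
  have hρs : HasCompactSupport ρ := (mollifier N hr n).hasCompactSupport_normed
  have hρc : ContDiff ℝ ∞ ρ := (mollifier N hr n).contDiff_normed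
  have hρd : Differentiable ℝ ρ := hρc.differentiable (by simp)
  have hder := hρs.hasFDerivAt_convolution_left (lsmul ℝ ℝ) (hρc.of_le (by simp)) hf x
  have hex := HasCompactSupport.convolutionExists_left
    (ContinuousLinearMap.precompL (Eucl N) (lsmul ℝ ℝ)) (hρs.fderiv (𝕜 := ℝ))
    (hρc.continuous_fderiv (by simp)) hf x
  rw [hasGradientAt_iff_hasFDerivAt]
  refine HasFDerivAt.congr_fderiv hder (Eq.symm ?_)
  have hgrad : ∀ t, gradient (fun t => ρ (x - t)) t = - gradient ρ (x - t) := fun t => by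
    refine HasGradientAt.gradient ?_
    rw [hasGradientAt_iff_hasFDerivAt, map_neg, toDual_gradient]
    have := (hρd (x - t)).hasFDerivAt.comp t ((hasFDerivAt_id t).const_sub x)
    refine HasFDerivAt.congr_fderiv this ?_
    ext v; simp
  -- The reflected kernel t ↦ ρ(x - t) is itself a test function. The sign from the reflection
  -- cancels the one in the weak gradient identity.
  have htest : IsTestFunction Set.univ (fun t => ρ (x - t)) := by
    refine ⟨hρc.comp (contDiff_const.sub contDiff_id), ?_, Set.subset_univ _⟩
    exact hρs.comp_homeomorph (Homeomorph.subLeft x)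
  have h := hw _ htest
  simp only [Measure.restrict_univ, hgrad, smul_neg, integral_neg, neg_inj] at h
  rw [convolution_eq_swap]
  have hex' := hex.integrable_swap
  have hval : mollify hr n g x = ∫ t, f t • gradient ρ (x - t) := by
    rw [h, mollify, convolution_lsmul_swap]
  have hint : Integrable fun t => f t • gradient ρ (x - t) := by
    have hgc : Continuous fun t => gradient ρ (x - t) := by
      have : Continuous (gradient ρ) :=
        (InnerProductSpace.toDual ℝ (Eucl N)).symm.continuous.comp
          (hρc.continuous_fderiv (by simp))
      exact this.comp (continuous_const.sub continuous_id)
    have hgs : HasCompactSupport fun t => gradient ρ (x - t) := by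
      have : HasCompactSupport (gradient ρ) := (hρs.fderiv (𝕜 := ℝ)).comp_left (map_zero _)
      exact this.comp_homeomorph (Homeomorph.subLeft x)
    exact hf.integrable_smul_right_of_hasCompactSupport hgc hgs
  ext v
  rw [InnerProductSpace.toDual_apply_apply, hval, ContinuousLinearMap.integral_apply hex',
    real_inner_comm, ← integral_inner hint]
  refine integral_congr_ae (Eventually.of_forall fun t => ?_)
  simp only [ContinuousLinearMap.precompL_apply, ContinuousLinearMap.lsmul_apply,
    real_inner_smul_right, smul_eq_mul]
  rw [real_inner_comm, inner_gradient_left, mul_comm]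

end Mollification

variable {N : ℕ}

/-! ### Gradients, test functions and the weak gradient identity on the whole space. -/

theorem continuous_gradient {φ : Eucl N → ℝ} (hφ : ContDiff ℝ ∞ φ) : Continuous (gradient φ) :=
  (InnerProductSpace.toDual ℝ (Eucl N)).symm.continuous.comp (hφ.continuous_fderiv (by simp))

theorem support_gradient_subset (φ : Eucl N → ℝ) :
    Function.support (gradient φ) ⊆ tsupport φ := fun x hx => by
  refine support_fderiv_subset ℝ (f := φ) fun h => hx ?_
  simp [gradient, h]

theorem gradient_eq_zero_of_notMem_tsupport {φ : Eucl N → ℝ} {x : Eucl N} (hx : x ∉ tsupport φ) :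
    gradient φ x = 0 := by
  by_contra h
  exact hx (support_gradient_subset φ h)

theorem tsupport_gradient_subset (φ : Eucl N → ℝ) : tsupport (gradient φ) ⊆ tsupport φ :=
  closure_minimal (support_gradient_subset φ) (isClosed_tsupport φ)

theorem hasCompactSupport_gradient {φ : Eucl N → ℝ} (hφ : HasCompactSupport φ) :
    HasCompactSupport (gradient φ) :=
  hφ.of_isClosed_subset (isClosed_tsupport _) (tsupport_gradient_subset φ)

theorem gradient_mul {a b : Eucl N → ℝ} {x : Eucl N} (ha : DifferentiableAt ℝ a x)
    (hb : DifferentiableAt ℝ b x) :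
    gradient (fun y => a y * b y) x = a x • gradient b x + b x • gradient a x := by
  refine HasGradientAt.gradient ?_
  rw [hasGradientAt_iff_hasFDerivAt, map_add, map_smul, map_smul, toDual_gradient,
    toDual_gradient]
  exact ha.hasFDerivAt.mul hb.hasFDerivAt

theorem gradient_comp {a : Eucl N → ℝ} {Φ : ℝ → ℝ} {d : ℝ} {x : Eucl N}
    (ha : DifferentiableAt ℝ a x) (hΦ : HasDerivAt Φ d (a x)) :
    gradient (fun y => Φ (a y)) x = d • gradient a x := by
  refine HasGradientAt.gradient ?_
  rw [hasGradientAt_iff_hasFDerivAt, map_smul, toDual_gradient]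
  exact hΦ.comp_hasFDerivAt x ha.hasFDerivAt

theorem tsupport_mul_subset_inter (a b : Eucl N → ℝ) :
    tsupport (fun x => a x * b x) ⊆ tsupport a ∩ tsupport b :=
  Set.subset_inter (tsupport_mul_subset_left (f := a) (g := b))
    (tsupport_mul_subset_right (f := a) (g := b))

theorem IsTestFunction.mul_left {G G' : Set (Eucl N)} {ζ χ : Eucl N → ℝ}
    (hζ : IsTestFunction G ζ) (hχ : ContDiff ℝ ∞ χ) (hG : G ∩ tsupport χ ⊆ G') :
    IsTestFunction G' (fun x => χ x * ζ x) :=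
  ⟨hχ.mul hζ.1, hζ.2.1.mul_left (f := χ), fun _ hx =>
    hG ⟨hζ.2.2 (tsupport_mul_subset_inter _ _ hx).2, (tsupport_mul_subset_inter _ _ hx).1⟩⟩

theorem IsTestFunction.mono {G G' : Set (Eucl N)} {ζ : Eucl N → ℝ}
    (hζ : IsTestFunction G ζ) (hG : G ⊆ G') : IsTestFunction G' ζ :=
  ⟨hζ.1, hζ.2.1, hζ.2.2.trans hG⟩

theorem integrable_smul_of_tsupport_subset {F : Type*} [NormedAddCommGroup F] [NormedSpace ℝ F]
    {G : Set (Eucl N)} {g : Eucl N → F}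
    (hg : LocallyIntegrableOn g G) {a : Eucl N → ℝ} (hac : Continuous a)
    (has : HasCompactSupport a) (haG : tsupport a ⊆ G) : Integrable fun x => a x • g x := by
  have h := (hg.integrableOn_compact_subset haG has).continuousOn_smul hac.continuousOn has
  refine (integrableOn_iff_integrable_of_support_subset fun x hx => ?_).1 h
  exact subset_tsupport a fun h0 => hx (by simp [h0])

theorem integrable_smul_of_tsupport_subset' {F : Type*} [NormedAddCommGroup F] [NormedSpace ℝ F]
    {G : Set (Eucl N)} {u : Eucl N → ℝ}
    (hu : LocallyIntegrableOn u G) {a : Eucl N → F} (hac : Continuous a)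
    (has : HasCompactSupport a) (haG : tsupport a ⊆ G) : Integrable fun x => u x • a x := by
  have h := (hu.integrableOn_compact_subset haG has).smul_continuousOn hac.continuousOn has
  refine (integrableOn_iff_integrable_of_support_subset fun x hx => ?_).1 h
  exact subset_tsupport a fun h0 => hx (by simp [h0])

/-- The weak gradient identity, written with integrals over the whole space. -/
theorem HasWeakGradient.integral_eq {G : Set (Eucl N)} {u : Eucl N → ℝ} {g : Eucl N → Eucl N}
    (h : HasWeakGradient G u g) {φ : Eucl N → ℝ} (hφ : IsTestFunction G φ) :
    ∫ x, u x • gradient φ x = -∫ x, φ x • g x := by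
  have h1 := h.2.2 φ hφ
  rwa [setIntegral_eq_integral_of_forall_compl_eq_zero,
    setIntegral_eq_integral_of_forall_compl_eq_zero] at h1
  · intro x hx
    rw [image_eq_zero_of_notMem_tsupport fun h' => hx (hφ.2.2 h'), zero_smul]
  · intro x hx
    rw [gradient_eq_zero_of_notMem_tsupport fun h' => hx (hφ.2.2 h'), smul_zero]

theorem HasWeakGradient.of_integral_eq {G : Set (Eucl N)} {u : Eucl N → ℝ} {g : Eucl N → Eucl N}
    (hu : LocallyIntegrableOn u G) (hg : LocallyIntegrableOn g G)
    (h : ∀ φ : Eucl N → ℝ, IsTestFunction G φ → ∫ x, u x • gradient φ x = -∫ x, φ x • g x) :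
    HasWeakGradient G u g := by
  refine ⟨hu, hg, fun φ hφ => ?_⟩
  rw [setIntegral_eq_integral_of_forall_compl_eq_zero,
    setIntegral_eq_integral_of_forall_compl_eq_zero, h φ hφ]
  · intro x hx
    rw [image_eq_zero_of_notMem_tsupport fun h' => hx (hφ.2.2 h'), zero_smul]
  · intro x hx
    rw [gradient_eq_zero_of_notMem_tsupport fun h' => hx (hφ.2.2 h'), smul_zero]

/-! ### Compactly supported Sobolev functions: products, sums and approximation. -/

/-- `f` is a continuous compactly supported function on `ℝ^N` with weak gradient `g` in `L²`. -/
structure IsCompactSobolev (f : Eucl N → ℝ) (g : Eucl N → Eucl N) : Prop where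
  continuous : Continuous f
  hasCompactSupport : HasCompactSupport f
  hasWeakGradient : HasWeakGradient Set.univ f g
  memLp : MemLp g 2 volume

theorem IsCompactSobolev.memLp_fun {f : Eucl N → ℝ} {g : Eucl N → Eucl N}
    (h : IsCompactSobolev f g) : MemLp f 2 volume :=
  h.continuous.memLp_of_hasCompactSupport h.hasCompactSupport

theorem isCompactSobolev_of_integral_eq {f : Eucl N → ℝ} {g : Eucl N → Eucl N}
    (hc : Continuous f) (hs : HasCompactSupport f) (hg : MemLp g 2 volume)
    (h : ∀ φ : Eucl N → ℝ, IsTestFunction Set.univ φ →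
      ∫ x, f x • gradient φ x = -∫ x, φ x • g x) : IsCompactSobolev f g :=
  ⟨hc, hs, .of_integral_eq (hc.locallyIntegrable.locallyIntegrableOn _)
    ((hg.locallyIntegrable (by norm_num)).locallyIntegrableOn _) h, hg⟩

theorem IsCompactSobolev.hasWeakGradient_on {f : Eucl N → ℝ} {g : Eucl N → Eucl N}
    (h : IsCompactSobolev f g) (G : Set (Eucl N)) : HasWeakGradient G f g :=
  .of_integral_eq (h.continuous.locallyIntegrable.locallyIntegrableOn _)
    ((h.memLp.locallyIntegrable (by norm_num)).locallyIntegrableOn _) fun _ hφ =>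
      h.hasWeakGradient.integral_eq (hφ.mono (Set.subset_univ _))

theorem IsCompactSobolev.memH1 {f : Eucl N → ℝ} {g : Eucl N → Eucl N}
    (h : IsCompactSobolev f g) (G : Set (Eucl N)) : MemH1 G f g :=
  ⟨h.hasWeakGradient_on G, h.memLp_fun.restrict G, h.memLp.restrict G⟩

theorem IsCompactSobolev.memH1c {f : Eucl N → ℝ} {g : Eucl N → Eucl N}
    (h : IsCompactSobolev f g) {G : Set (Eucl N)} (hG : tsupport f ⊆ G) : MemH1c G f g :=
  ⟨h.memH1 G, tsupport f, h.hasCompactSupport, hG,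
    Eventually.of_forall fun _ hx => image_eq_zero_of_notMem_tsupport hx⟩

/-- The product of an `H^1_loc(G)` function with a test function of `G`. -/
theorem MemH1loc.isCompactSobolev_mul {G : Set (Eucl N)} (hGo : IsOpen G) {v : Eucl N → ℝ}
    {g : Eucl N → Eucl N} (hv : MemH1loc G v g) (hvc : ContinuousOn v G) {ζ : Eucl N → ℝ}
    (hζ : IsTestFunction G ζ) :
    IsCompactSobolev (fun x => ζ x * v x) (fun x => ζ x • g x + v x • gradient ζ x) := by
  have hc : Continuous fun x => ζ x * v x :=
    ContinuousOn.continuous_of_tsupport_subset (hζ.1.continuous.continuousOn.mul hvc) hGo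
      ((tsupport_mul_subset_inter ζ v).trans Set.inter_subset_left |>.trans hζ.2.2)
  have hs : HasCompactSupport fun x => ζ x * v x := hζ.2.1.mul_right (f' := v)
  have hgr : Continuous fun x => v x • gradient ζ x :=
    ContinuousOn.continuous_of_tsupport_subset
      (hvc.smul (continuous_gradient hζ.1).continuousOn) hGo
      ((tsupport_smul_subset_right v (gradient ζ)).trans
        ((tsupport_gradient_subset ζ).trans hζ.2.2))
  have hgs : HasCompactSupport fun x => v x • gradient ζ x :=
    (hasCompactSupport_gradient hζ.2.1).smul_left (f := v)
  obtain ⟨C, hC⟩ := hζ.2.1.exists_bound_of_continuous hζ.1.continuous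
  have hmem : MemLp (fun x => ζ x • g x) 2 volume := by
    have h1 : (fun x => ζ x • g x) = (tsupport ζ).indicator fun x => ζ x • g x := by
      refine (Set.indicator_eq_self.2 fun x hx => subset_tsupport ζ fun h0 => hx ?_).symm
      simp [h0]
    rw [h1, memLp_indicator_iff_restrict hζ.2.1.isCompact.measurableSet]
    have h2 := (hv.2 _ hζ.2.1 hζ.2.2).2
    refine h2.of_le_mul (c := C) (hζ.1.continuous.aestronglyMeasurable.smul h2.1)
      (Eventually.of_forall fun x => ?_)
    rw [norm_smul]
    gcongr
    exact hC x
  refine isCompactSobolev_of_integral_eq hc hs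
    (hmem.add (hgr.memLp_of_hasCompactSupport hgs)) fun φ hφ => ?_
  -- φ need not be supported in G, but φζ is, so the identity for v applies to φζ. The product rule
  -- then moves ∇ζ to the other side.
  have hζφ : IsTestFunction G fun x => φ x * ζ x := hζ.mul_left hφ.1 Set.inter_subset_left
  have hprod : ∀ x, gradient (fun y => φ y * ζ y) x
      = φ x • gradient ζ x + ζ x • gradient φ x := fun x =>
    gradient_mul (hφ.1.differentiable (by simp) x) (hζ.1.differentiable (by simp) x)
  have h := hv.1.integral_eq hζφ
  have i1 : Integrable fun x => v x • (φ x • gradient ζ x) := by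
    have hs1 : tsupport (fun x => φ x • gradient ζ x) ⊆ tsupport ζ :=
      (tsupport_smul_subset_right φ (gradient ζ)).trans (tsupport_gradient_subset ζ)
    exact integrable_smul_of_tsupport_subset' hv.1.1
      (hφ.1.continuous.smul (continuous_gradient hζ.1))
      (hζ.2.1.of_isClosed_subset (isClosed_tsupport _) hs1) (hs1.trans hζ.2.2)
  have i2 : Integrable fun x => v x • (ζ x • gradient φ x) := by
    have hs1 : tsupport (fun x => ζ x • gradient φ x) ⊆ tsupport ζ :=
      tsupport_smul_subset_left ζ (gradient φ)
    exact integrable_smul_of_tsupport_subset' hv.1.1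
      (hζ.1.continuous.smul (continuous_gradient hφ.1))
      (hζ.2.1.of_isClosed_subset (isClosed_tsupport _) hs1) (hs1.trans hζ.2.2)
  have i3 : Integrable fun x => (φ x * ζ x) • g x :=
    integrable_smul_of_tsupport_subset hv.1.2.1 hζφ.1.continuous hζφ.2.1 hζφ.2.2
  simp only [hprod, smul_add] at h
  rw [integral_add i1 i2] at h
  have e1 : ∀ x, φ x • (ζ x • g x + v x • gradient ζ x)
      = (φ x * ζ x) • g x + v x • (φ x • gradient ζ x) := fun x => by
    rw [smul_add, smul_smul, smul_comm (φ x) (v x)]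
  have e2 : ∀ x, (ζ x * v x) • gradient φ x = v x • (ζ x • gradient φ x) := fun x => by
    rw [smul_smul, mul_comm]
  simp only [e1, e2]
  rw [integral_add i3 i1, neg_add, ← h]
  abel

theorem IsCompactSobolev.sub_const_mul {f₁ f₂ : Eucl N → ℝ} {g₁ g₂ : Eucl N → Eucl N}
    (h₁ : IsCompactSobolev f₁ g₁) (h₂ : IsCompactSobolev f₂ g₂) (c : ℝ) :
    IsCompactSobolev (fun x => f₁ x - c * f₂ x) (fun x => g₁ x - c • g₂ x) := by
  refine isCompactSobolev_of_integral_eq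
    (h₁.continuous.sub (h₂.continuous.const_mul c)) ?_ (h₁.memLp.sub (h₂.memLp.const_smul c))
    fun φ hφ => ?_
  · exact h₁.hasCompactSupport.sub (h₂.hasCompactSupport.mul_left (f := fun _ => c))
  · have a1 := integrable_smul_of_tsupport_subset' h₁.hasWeakGradient.1 (continuous_gradient hφ.1)
      (hasCompactSupport_gradient hφ.2.1) (Set.subset_univ _)
    have a2 := integrable_smul_of_tsupport_subset' h₂.hasWeakGradient.1 (continuous_gradient hφ.1)
      (hasCompactSupport_gradient hφ.2.1) (Set.subset_univ _)
    have b1 := integrable_smul_of_tsupport_subset h₁.hasWeakGradient.2.1 hφ.1.continuous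
      hφ.2.1 hφ.2.2
    have b2 := integrable_smul_of_tsupport_subset h₂.hasWeakGradient.2.1 hφ.1.continuous
      hφ.2.1 hφ.2.2
    have e1 : ∀ x, (f₁ x - c * f₂ x) • gradient φ x
        = f₁ x • gradient φ x - c • (f₂ x • gradient φ x) := fun x => by
      rw [sub_smul, mul_smul]
    have e2 : ∀ x, φ x • (g₁ x - c • g₂ x) = φ x • g₁ x - c • (φ x • g₂ x) := fun x => by
      rw [smul_sub, smul_comm]
    simp only [e1, e2]
    rw [integral_sub a1 (a2.fun_smul c), integral_sub b1 (b2.fun_smul c), integral_smul, integral_smul,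
      h₁.hasWeakGradient.integral_eq hφ, h₂.hasWeakGradient.integral_eq hφ, smul_neg]
    abel

/-- The product of a compactly supported Sobolev function with a smooth function. -/
theorem IsCompactSobolev.smooth_mul {f χ : Eucl N → ℝ} {g : Eucl N → Eucl N}
    (h : IsCompactSobolev f g) (hχ : ContDiff ℝ ∞ χ) (hg : ∀ x, x ∉ tsupport f → g x = 0) :
    IsCompactSobolev (fun x => χ x * f x) (fun x => χ x • g x + f x • gradient χ x) := by
  have hc : Continuous fun x => f x • gradient χ x := h.continuous.smul (continuous_gradient hχ)
  have hs : HasCompactSupport fun x => f x • gradient χ x :=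
    h.hasCompactSupport.smul_right (f' := gradient χ)
  -- χ may be unbounded on ℝ^N. A bound on the support of f is enough, because `hg` makes g vanish
  -- elsewhere.
  obtain ⟨C, hC⟩ := h.hasCompactSupport.isCompact.exists_bound_of_continuousOn
    hχ.continuous.continuousOn
  have hmem : MemLp (fun x => χ x • g x) 2 volume := by
    refine h.memLp.of_le_mul (c := C) (hχ.continuous.aestronglyMeasurable.smul h.memLp.1)
      (Eventually.of_forall fun x => ?_)
    rw [norm_smul]
    by_cases hx : x ∈ tsupport f
    · gcongr
      exact hC x hx
    · simp [hg x hx]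
  refine isCompactSobolev_of_integral_eq (hχ.continuous.mul h.continuous)
    (h.hasCompactSupport.mul_left (f := χ)) (hmem.add (hc.memLp_of_hasCompactSupport hs))
    fun φ hφ => ?_
  have hχφ : IsTestFunction Set.univ fun x => χ x * φ x := hφ.mul_left hχ (Set.subset_univ _)
  have hprod : ∀ x, gradient (fun y => χ y * φ y) x
      = χ x • gradient φ x + φ x • gradient χ x := fun x =>
    gradient_mul (hχ.differentiable (by simp) x) (hφ.1.differentiable (by simp) x)
  have hw := h.hasWeakGradient.integral_eq hχφ
  have i1 : Integrable fun x => f x • (χ x • gradient φ x) :=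
    (h.continuous.smul (hχ.continuous.smul (continuous_gradient hφ.1))).integrable_of_hasCompactSupport
      (h.hasCompactSupport.smul_right (f' := fun x => χ x • gradient φ x))
  have i2 : Integrable fun x => f x • (φ x • gradient χ x) :=
    (h.continuous.smul (hφ.1.continuous.smul (continuous_gradient hχ))).integrable_of_hasCompactSupport
      (h.hasCompactSupport.smul_right (f' := fun x => φ x • gradient χ x))
  have i3 : Integrable fun x => (χ x * φ x) • g x :=
    integrable_smul_of_tsupport_subset h.hasWeakGradient.2.1 hχφ.1.continuous hχφ.2.1 hχφ.2.2
  simp only [hprod, smul_add] at hw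
  rw [integral_add i1 i2] at hw
  have e1 : ∀ x, φ x • (χ x • g x + f x • gradient χ x)
      = (χ x * φ x) • g x + f x • (φ x • gradient χ x) := fun x => by
    rw [smul_add, smul_smul, mul_comm, smul_comm (φ x) (f x)]
  have e2 : ∀ x, (χ x * f x) • gradient φ x = f x • (χ x • gradient φ x) := fun x => by
    rw [smul_smul, mul_comm]
  simp only [e1, e2]
  rw [integral_add i3 i2, neg_add, ← hw]
  abel

/-- Approximation of a compactly supported Sobolev function by test functions. -/
theorem IsCompactSobolev.exists_approx {f : Eucl N → ℝ} {g : Eucl N → Eucl N}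
    (h : IsCompactSobolev f g) {G : Set (Eucl N)} (hG : IsOpen G) (hfG : tsupport f ⊆ G) :
    ∃ φ : ℕ → Eucl N → ℝ, (∀ n, IsTestFunction G (φ n)) ∧
      (∀ x, Tendsto (fun n => φ n x) atTop (𝓝 (f x))) ∧
      Tendsto (fun n => eLpNorm (fun x => φ n x - f x) 2 volume) atTop (𝓝 0) ∧
      Tendsto (fun n => eLpNorm (fun x => gradient (φ n) x - g x) 2 volume) atTop (𝓝 0) := by
  -- This r is the largest mollification scale, so every approximant stays supported in G.
  obtain ⟨r, hr, hrG⟩ := h.hasCompactSupport.isCompact.exists_cthickening_subset_open hG hfG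
  have hK : IsCompact (Metric.cthickening r (tsupport f)) :=
    h.hasCompactSupport.isCompact.cthickening
  have hgrad : ∀ n, gradient (mollify hr n f) = mollify hr n g := fun n =>
    funext fun x => (hasGradientAt_mollify hr n h.hasWeakGradient x).gradient
  have hsupp : ∀ n, tsupport (mollify hr n f) ⊆ Metric.cthickening r (tsupport f) := fun n =>
    closure_minimal (fun x hx => by
      by_contra h'
      exact hx (mollify_eq_zero hr n h')) hK.isClosed
  refine ⟨fun n => mollify hr n f, fun n => ⟨?_, ?_, (hsupp n).trans hrG⟩, fun x => ?_, ?_, ?_⟩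
  · exact (mollifier N hr n).hasCompactSupport_normed.contDiff_convolution_left _
      (mollifier N hr n).contDiff_normed h.continuous.locallyIntegrable
  · exact hK.of_isClosed_subset (isClosed_tsupport _) (hsupp n)
  · exact ContDiffBump.convolution_tendsto_right_of_continuous (tendsto_mollifier_rOut hr)
      h.continuous x
  · exact tendsto_eLpNorm_mollify_sub hr h.memLp_fun
  · simp only [hgrad]
    exact tendsto_eLpNorm_mollify_sub hr h.memLp

/-- Makes the truncation w admissible in the inequality that defines `hardyConstant`. -/
theorem IsCompactSobolev.memH10 {f : Eucl N → ℝ} {g : Eucl N → Eucl N}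
    (h : IsCompactSobolev f g) {G : Set (Eucl N)} (hG : IsOpen G) (hfG : tsupport f ⊆ G) :
    MemH10 G f g := by
  obtain ⟨φ, h1, -, h3, h4⟩ := h.exists_approx hG hfG
  refine ⟨h.memH1 G, φ, h1, ?_, ?_⟩
  · exact tendsto_of_tendsto_of_tendsto_of_le_of_le tendsto_const_nhds h3
      (fun _ => zero_le) fun n => eLpNorm_mono_measure _ Measure.restrict_le_self
  · exact tendsto_of_tendsto_of_tendsto_of_le_of_le tendsto_const_nhds h4
      (fun _ => zero_le) fun n => eLpNorm_mono_measure _ Measure.restrict_le_self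

/-! ### Limits of L² pairings and the chain rule. -/

theorem enorm_integral_smul_le {F : Type*} [NormedAddCommGroup F] [NormedSpace ℝ F]
    {c : Eucl N → ℝ} {d : Eucl N → F} (hc : AEStronglyMeasurable c volume)
    (hd : AEStronglyMeasurable d volume) :
    ‖∫ x, c x • d x‖ₑ ≤ eLpNorm c 2 volume * eLpNorm d 2 volume := by
  refine (enorm_integral_le_lintegral_enorm _).trans ?_
  rw [← eLpNorm_one_eq_lintegral_enorm]
  exact eLpNorm_smul_le_mul_eLpNorm hd hc

theorem integrable_smul_of_memLp {F : Type*} [NormedAddCommGroup F] [NormedSpace ℝ F]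
    {c : Eucl N → ℝ} {d : Eucl N → F} (hc : MemLp c 2 volume) (hd : MemLp d 2 volume) :
    Integrable fun x => c x • d x :=
  memLp_one_iff_integrable.1 (hd.smul hc)

/-- Cauchy–Schwarz. The disjunction allows either factor to be the one that tends to 0 while the
other stays bounded. -/
theorem tendsto_integral_smul {F : Type*} [NormedAddCommGroup F] [NormedSpace ℝ F]
    {c : ℕ → Eucl N → ℝ} {d : ℕ → Eucl N → F} {C : ENNReal}
    (hc : ∀ n, AEStronglyMeasurable (c n) volume) (hd : ∀ n, AEStronglyMeasurable (d n) volume)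
    (hC : C ≠ ⊤) (h : (∀ n, eLpNorm (c n) 2 volume ≤ C) ∧
        Tendsto (fun n => eLpNorm (d n) 2 volume) atTop (𝓝 0) ∨
      (∀ n, eLpNorm (d n) 2 volume ≤ C) ∧
        Tendsto (fun n => eLpNorm (c n) 2 volume) atTop (𝓝 0)) :
    Tendsto (fun n => ∫ x, c n x • d n x) atTop (𝓝 0) := by
  rw [tendsto_zero_iff_enorm_tendsto_zero]
  rcases h with ⟨hb, hl⟩ | ⟨hb, hl⟩
  · have hl' : Tendsto (fun n => C * eLpNorm (d n) 2 volume) atTop (𝓝 0) := by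
      simpa using ENNReal.Tendsto.const_mul hl (Or.inr hC)
    refine tendsto_of_tendsto_of_tendsto_of_le_of_le tendsto_const_nhds hl' (fun _ => zero_le)
      fun n => (enorm_integral_smul_le (hc n) (hd n)).trans ?_
    gcongr
    exact hb n
  · have hl' : Tendsto (fun n => eLpNorm (c n) 2 volume * C) atTop (𝓝 0) := by
      simpa using ENNReal.Tendsto.mul_const hl (Or.inr hC)
    refine tendsto_of_tendsto_of_tendsto_of_le_of_le tendsto_const_nhds hl' (fun _ => zero_le)
      fun n => (enorm_integral_smul_le (hc n) (hd n)).trans ?_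
    gcongr
    exact hb n

/-- Integration by parts for `C^1` functions, one of them with compact support. -/
theorem integral_smul_gradient_eq_neg {a φ : Eucl N → ℝ} (ha : ContDiff ℝ 1 a)
    (hφ : ContDiff ℝ ∞ φ) (hs : HasCompactSupport φ) :
    ∫ x, a x • gradient φ x = -∫ x, φ x • gradient a x := by
  have hac : Continuous (gradient a) :=
    (InnerProductSpace.toDual ℝ (Eucl N)).symm.continuous.comp (ha.continuous_fderiv (by simp))
  have i1 : Integrable fun x => a x • gradient φ x :=
    (ha.continuous.smul (continuous_gradient hφ)).integrable_of_hasCompactSupport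
      ((hasCompactSupport_gradient hs).smul_left (f := a))
  have i2 : Integrable fun x => φ x • gradient a x :=
    (hφ.continuous.smul hac).integrable_of_hasCompactSupport
      (hs.smul_right (f' := gradient a))
  have i3 : Integrable fun x => a x * φ x :=
    (ha.continuous.mul hφ.continuous).integrable_of_hasCompactSupport (hs.mul_left (f := a))
  -- Pairing with an arbitrary v reduces the vector identity to integration by parts for one
  -- directional derivative.
  refine ext_inner_left ℝ fun v => ?_
  rw [inner_neg_right, ← integral_inner i1, ← integral_inner i2]
  simp only [real_inner_smul_right]
  have j1 : Integrable fun x => a x * fderiv ℝ φ x v := by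
    have := i1.const_inner v (𝕜 := ℝ)
    refine this.congr (Eventually.of_forall fun x => ?_)
    simp [real_inner_smul_right, inner_gradient_right]
  have j2 : Integrable fun x => fderiv ℝ a x v * φ x := by
    have := i2.const_inner v (𝕜 := ℝ)
    refine this.congr (Eventually.of_forall fun x => ?_)
    simp [real_inner_smul_right, inner_gradient_right, mul_comm]
  have h := integral_mul_fderiv_eq_neg_fderiv_mul_of_integrable j2 j1 i3
    (fun x _ => ha.differentiable (by simp) x) (fun x _ => hφ.differentiable (by simp) x)
  simp only [inner_gradient_right, conj_trivial]
  rw [h]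
  simp only [mul_comm]

/-- Chain rule for a `C^1` function with bounded derivative. -/
theorem IsCompactSobolev.comp {f : Eucl N → ℝ} {g : Eucl N → Eucl N} (h : IsCompactSobolev f g)
    {Φ Φ' : ℝ → ℝ} (hΦ : ∀ t, HasDerivAt Φ (Φ' t) t) (hΦ'c : Continuous Φ')
    (hΦ'1 : ∀ t, |Φ' t| ≤ 1) (hΦ0 : Φ 0 = 0) :
    IsCompactSobolev (fun x => Φ (f x)) (fun x => Φ' (f x) • g x) := by
  have hΦc : Continuous Φ := continuous_iff_continuousAt.2 fun t => (hΦ t).continuousAt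
  have hΦC1 : ContDiff ℝ 1 Φ := by
    rw [contDiff_one_iff_deriv]
    exact ⟨fun t => (hΦ t).differentiableAt, by rwa [show deriv Φ = Φ' from
      funext fun t => (hΦ t).deriv]⟩
  have hlip : ∀ a b, |Φ a - Φ b| ≤ |a - b| := fun a b => by
    have := Convex.norm_image_sub_le_of_norm_hasDerivWithin_le (f := Φ) (f' := Φ') (C := 1)
      (s := Set.univ) (x := b) (y := a) (fun t _ => (hΦ t).hasDerivWithinAt)
      (fun t _ => hΦ'1 t) convex_univ trivial trivial
    simpa using this
  have hmeas : AEStronglyMeasurable (fun x => Φ' (f x)) volume :=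
    (hΦ'c.comp h.continuous).aestronglyMeasurable
  have hmem : MemLp (fun x => Φ' (f x) • g x) 2 volume := by
    refine h.memLp.of_le (hmeas.smul h.memLp.1) (Eventually.of_forall fun x => ?_)
    rw [norm_smul]
    exact mul_le_of_le_one_left (norm_nonneg _) (hΦ'1 _)
  refine isCompactSobolev_of_integral_eq (hΦc.comp h.continuous)
    (h.hasCompactSupport.comp_left hΦ0) hmem fun φ hφ => ?_
  obtain ⟨a, ha, hpt, hL, hLg⟩ := h.exists_approx isOpen_univ (Set.subset_univ _)
  have hibp : ∀ n, ∫ x, Φ (a n x) • gradient φ x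
      = -∫ x, (φ x * Φ' (a n x)) • gradient (a n) x := fun n => by
    have hg : ∀ x, gradient (fun y => Φ (a n y)) x = Φ' (a n x) • gradient (a n) x := fun x =>
      gradient_comp ((ha n).1.differentiable (by simp) x) (hΦ _)
    have := integral_smul_gradient_eq_neg (hΦC1.comp ((ha n).1.of_le (by simp))) hφ.1 hφ.2.1
    simp only [Function.comp_def, hg, smul_smul] at this
    exact this
  have hφ2 : MemLp φ 2 volume := hφ.1.continuous.memLp_of_hasCompactSupport hφ.2.1
  have hgφ2 : MemLp (gradient φ) 2 volume :=
    (continuous_gradient hφ.1).memLp_of_hasCompactSupport (hasCompactSupport_gradient hφ.2.1)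
  have hac : ∀ n, Continuous (a n) := fun n => (ha n).1.continuous
  have hΦa : ∀ n, MemLp (fun x => Φ (a n x)) 2 volume := fun n =>
    (hΦc.comp (hac n)).memLp_of_hasCompactSupport ((ha n).2.1.comp_left hΦ0)
  have hΦf : MemLp (fun x => Φ (f x)) 2 volume :=
    (hΦc.comp h.continuous).memLp_of_hasCompactSupport (h.hasCompactSupport.comp_left hΦ0)
  have hgm : ∀ n, MemLp (gradient (a n)) 2 volume := fun n =>
    (continuous_gradient (ha n).1).memLp_of_hasCompactSupport
      (hasCompactSupport_gradient (ha n).2.1)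
  have hcm : ∀ n, MemLp (fun x => φ x * Φ' (a n x)) 2 volume := fun n =>
    (hφ.1.continuous.mul (hΦ'c.comp (hac n))).memLp_of_hasCompactSupport
      (hφ.2.1.mul_right (f' := fun x => Φ' (a n x)))
  have lim1 : Tendsto (fun n => ∫ x, Φ (a n x) • gradient φ x) atTop
      (𝓝 (∫ x, Φ (f x) • gradient φ x)) := by
    rw [← tendsto_sub_nhds_zero_iff]
    have := tendsto_integral_smul (c := fun n x => Φ (a n x) - Φ (f x))
      (d := fun _ => gradient φ) (fun n => ((hΦa n).sub hΦf).1) (fun _ => hgφ2.1)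
      hgφ2.2.ne (Or.inr ⟨fun _ => le_rfl, ?_⟩)
    · refine this.congr fun n => ?_
      rw [← integral_sub (integrable_smul_of_memLp (hΦa n) hgφ2)
        (integrable_smul_of_memLp hΦf hgφ2)]
      simp only [sub_smul]
    · exact tendsto_of_tendsto_of_tendsto_of_le_of_le tendsto_const_nhds hL
        (fun _ => zero_le) fun n => eLpNorm_mono fun x => hlip _ _
  -- The term φ Φ'(aₙ) ∇aₙ is split: ∇aₙ - g tends to 0 in L² against a bounded factor, and in φ
  -- Φ'(aₙ) g only the coefficient varies, so pointwise convergence and domination suffice.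
  have lim2 : Tendsto (fun n => ∫ x, (φ x * Φ' (a n x)) • (gradient (a n) x - g x)) atTop
      (𝓝 0) := by
    refine tendsto_integral_smul (fun n => (hcm n).1) (fun n => ((hgm n).sub h.memLp).1)
      hφ2.2.ne (Or.inl ⟨fun n => eLpNorm_mono fun x => ?_, hLg⟩)
    rw [norm_mul]
    exact mul_le_of_le_one_right (norm_nonneg _) (hΦ'1 _)
  have lim3 : Tendsto (fun n => ∫ x, (φ x * Φ' (a n x)) • g x) atTop
      (𝓝 (∫ x, (φ x * Φ' (f x)) • g x)) := by
    refine tendsto_integral_of_dominated_convergence (fun x => ‖φ x • g x‖)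
      (fun n => (hcm n).1.smul h.memLp.1) (integrable_smul_of_memLp hφ2 h.memLp).norm
      (fun n => Eventually.of_forall fun x => ?_) (Eventually.of_forall fun x => ?_)
    · rw [norm_smul, norm_smul, norm_mul]
      gcongr
      exact mul_le_of_le_one_right (norm_nonneg _) (hΦ'1 _)
    · exact (((hΦ'c.tendsto _).comp (hpt x)).const_mul (φ x)).smul_const (g x)
  have lim4 : Tendsto (fun n => ∫ x, Φ (a n x) • gradient φ x) atTop
      (𝓝 (-∫ x, (φ x * Φ' (f x)) • g x)) := by
    have := (lim2.add lim3).neg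
    rw [zero_add] at this
    refine this.congr fun n => ?_
    have hi : Integrable fun x => (φ x * Φ' (a n x)) • (gradient (a n) x - g x) :=
      integrable_smul_of_memLp (hcm n) ((hgm n).sub h.memLp)
    rw [hibp n, ← integral_add hi (integrable_smul_of_memLp (hcm n) h.memLp)]
    simp only [smul_sub, sub_add_cancel]
  simp only [smul_smul]
  exact tendsto_nhds_unique lim1 lim4

/-! ### The weak gradient of the positive part. -/

/-- A `C^1` regularization of the positive part. -/
def regPos (η t : ℝ) : ℝ := √(max t 0 ^ 2 + η ^ 2) - η

/-- The derivative of `regPos η`. -/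
def regPosDeriv (η t : ℝ) : ℝ := max t 0 / √(max t 0 ^ 2 + η ^ 2)

/-- Squaring removes the kink of the positive part: at 0 the function is dominated by t², whose
derivative there is 0. -/
theorem hasDerivAt_max_zero_sq (t : ℝ) : HasDerivAt (fun t : ℝ => max t 0 ^ 2) (2 * max t 0) t := by
  rcases lt_trichotomy t 0 with ht | rfl | ht
  · rw [max_eq_right ht.le, mul_zero]
    refine (hasDerivAt_const t 0).congr_of_eventuallyEq ?_
    filter_upwards [gt_mem_nhds ht] with s hs
    rw [max_eq_right (le_of_lt hs)]; norm_num
  · have h : HasDerivAt (fun t : ℝ => t ^ 2) 0 0 := by simpa using hasDerivAt_pow 2 (0 : ℝ)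
    rw [max_self, mul_zero]
    rw [hasDerivAt_iff_isLittleO_nhds_zero] at h ⊢
    refine Asymptotics.IsBigO.trans_isLittleO (Asymptotics.IsBigO.of_bound 1 ?_) h
    refine Eventually.of_forall fun s => ?_
    simp only [zero_add, max_self, smul_zero, sub_zero, one_mul, norm_pow,
      ne_eq, OfNat.ofNat_ne_zero, not_false_eq_true, zero_pow]
    gcongr
    rcases le_total s 0 with hs | hs
    · simp [max_eq_right hs]
    · simp [max_eq_left hs]
  · rw [max_eq_left ht.le]
    have h : HasDerivAt (fun t : ℝ => t ^ 2) (2 * t) t := by simpa using hasDerivAt_pow 2 t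
    refine h.congr_of_eventuallyEq ?_
    filter_upwards [lt_mem_nhds ht] with s hs
    rw [max_eq_left (le_of_lt hs)]

theorem hasDerivAt_regPos {η : ℝ} (hη : 0 < η) (t : ℝ) :
    HasDerivAt (regPos η) (regPosDeriv η t) t := by
  have h := (((hasDerivAt_max_zero_sq t).add_const (η ^ 2)).sqrt (by positivity)).sub_const η
  exact h.congr_deriv (mul_div_mul_left _ _ two_ne_zero)

theorem continuous_regPosDeriv {η : ℝ} (hη : 0 < η) : Continuous (regPosDeriv η) := by
  refine Continuous.div (by fun_prop) (by fun_prop) fun t => ?_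
  positivity

theorem abs_regPosDeriv_le {η : ℝ} (hη : 0 < η) (t : ℝ) : |regPosDeriv η t| ≤ 1 := by
  have h0 : 0 ≤ max t 0 := le_max_right _ _
  rw [regPosDeriv, abs_of_nonneg (by positivity)]
  refine div_le_one_of_le₀ ?_ (by positivity)
  exact Real.le_sqrt_of_sq_le (by nlinarith)

theorem regPos_zero {η : ℝ} (hη : 0 < η) : regPos η 0 = 0 := by
  simp [regPos, Real.sqrt_sq hη.le]

theorem abs_regPos_le {η : ℝ} (hη : 0 < η) (t : ℝ) : |regPos η t| ≤ |t| := by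
  have h := Convex.norm_image_sub_le_of_norm_hasDerivWithin_le (f := regPos η)
    (f' := regPosDeriv η) (C := 1) (s := Set.univ) (x := 0) (y := t)
    (fun t _ => (hasDerivAt_regPos hη t).hasDerivWithinAt)
    (fun t _ => abs_regPosDeriv_le hη t) convex_univ trivial trivial
  simpa [regPos_zero hη] using h

theorem tendsto_regPos (t : ℝ) : Tendsto (fun η => regPos η t) (𝓝 0) (𝓝 (max t 0)) := by
  have hc : Continuous fun η => regPos η t := by unfold regPos; fun_prop
  have h := hc.tendsto 0
  simpa [regPos, Real.sqrt_sq (le_max_right t 0)] using h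

/-- For t ≤ 0 the derivative is 0 for every η. Hence the limit is the indicator of the strict
inequality, and nothing need be known about ∇f on {f = 0}. -/
theorem tendsto_regPosDeriv (t : ℝ) :
    Tendsto (fun η => regPosDeriv η t) (𝓝 0) (𝓝 (if 0 < t then 1 else 0)) := by
  split_ifs with ht
  · have hc : ContinuousAt (fun η => regPosDeriv η t) 0 := by
      unfold regPosDeriv
      refine ContinuousAt.div (by fun_prop) (by fun_prop) ?_
      have : 0 < max t 0 := lt_max_of_lt_left ht
      positivity
    have h := hc.tendsto
    simp only [regPosDeriv, max_eq_left ht.le, ne_eq, OfNat.ofNat_ne_zero, not_false_eq_true,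
      zero_pow, add_zero, Real.sqrt_sq ht.le, div_self ht.ne'] at h
    simpa only [regPosDeriv, max_eq_left ht.le] using h
  · simp [regPosDeriv, max_eq_right (not_lt.1 ht)]

/-- The positive part of a compactly supported Sobolev function. -/
theorem IsCompactSobolev.posPart {f : Eucl N → ℝ} {g : Eucl N → Eucl N}
    (h : IsCompactSobolev f g) :
    IsCompactSobolev (fun x => max (f x) 0) ({x | 0 < f x}.indicator g) := by
  have hmeas : MeasurableSet {x | 0 < f x} := (isOpen_lt continuous_const h.continuous).measurableSet
  refine isCompactSobolev_of_integral_eq (h.continuous.max continuous_const)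
    (h.hasCompactSupport.comp_left (g := fun t => max t 0) (max_self 0))
    (h.memLp.indicator hmeas) fun φ hφ => ?_
  set η : ℕ → ℝ := fun n => 1 / ((n : ℝ) + 1)
  have hη : ∀ n, 0 < η n := fun n => Nat.one_div_pos_of_nat
  have hη0 : Tendsto η atTop (𝓝 0) := tendsto_one_div_add_atTop_nhds_zero_nat
  have hcs := fun n => h.comp (hasDerivAt_regPos (hη n)) (continuous_regPosDeriv (hη n))
    (abs_regPosDeriv_le (hη n)) (regPos_zero (hη n))
  have hid := fun n => (hcs n).hasWeakGradient.integral_eq hφ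
  have hφ2 : MemLp φ 2 volume := hφ.1.continuous.memLp_of_hasCompactSupport hφ.2.1
  have hgφ2 : MemLp (gradient φ) 2 volume :=
    (continuous_gradient hφ.1).memLp_of_hasCompactSupport (hasCompactSupport_gradient hφ.2.1)
  have lim1 : Tendsto (fun n => ∫ x, regPos (η n) (f x) • gradient φ x) atTop
      (𝓝 (∫ x, max (f x) 0 • gradient φ x)) := by
    refine tendsto_integral_of_dominated_convergence (fun x => ‖f x • gradient φ x‖)
      (fun n => (hcs n).memLp_fun.1.smul hgφ2.1) (integrable_smul_of_memLp h.memLp_fun hgφ2).norm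
      (fun n => Eventually.of_forall fun x => ?_) (Eventually.of_forall fun x => ?_)
    · rw [norm_smul, norm_smul]
      gcongr
      exact abs_regPos_le (hη n) _
    · exact ((tendsto_regPos (f x)).comp hη0).smul_const _
  have lim2 : Tendsto (fun n => ∫ x, φ x • regPosDeriv (η n) (f x) • g x) atTop
      (𝓝 (∫ x, φ x • {x | 0 < f x}.indicator g x)) := by
    refine tendsto_integral_of_dominated_convergence (fun x => ‖φ x • g x‖)
      (fun n => hφ2.1.smul (hcs n).memLp.1) (integrable_smul_of_memLp hφ2 h.memLp).norm
      (fun n => Eventually.of_forall fun x => ?_) (Eventually.of_forall fun x => ?_)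
    · rw [norm_smul, norm_smul, norm_smul]
      gcongr
      exact mul_le_of_le_one_left (norm_nonneg _) (abs_regPosDeriv_le (hη n) _)
    · have h1 := (((tendsto_regPosDeriv (f x)).comp hη0).smul_const (g x)).const_smul (φ x)
      have h2 : (if 0 < f x then (1 : ℝ) else 0) • g x = {x | 0 < f x}.indicator g x := by
        by_cases hx : 0 < f x <;> simp [hx]
      rwa [h2] at h1
  exact tendsto_nhds_unique lim1 (lim2.neg.congr fun n => (hid n).symm)

/-! ### The distance to the boundary and the Hardy inequality. -/

theorem continuous_bdryDist (Ω : Set (Eucl N)) : Continuous (bdryDist Ω) :=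
  Metric.continuous_infDist_pt _

/-- `Metric.infDist` to the empty set is 0, so positivity of δ on Ω needs a boundary point. One
exists because ℝ^N is unbounded for N > 0. -/
theorem frontier_nonempty_of_isBounded (hN : 0 < N) {Ω : Set (Eucl N)} (hne : Ω.Nonempty)
    (hb : Bornology.IsBounded Ω) : (frontier Ω).Nonempty := by
  have : Nonempty (Fin N) := ⟨⟨0, hN⟩⟩
  have : Nontrivial (Eucl N) := inferInstance
  refine nonempty_frontier_iff.2 ⟨hne, fun h => ?_⟩
  rw [h] at hb
  exact NormedSpace.unbounded_univ ℝ (Eucl N) hb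

theorem bdryDist_pos {Ω : Set (Eucl N)} (hΩ : IsOpen Ω) (hf : (frontier Ω).Nonempty)
    {x : Eucl N} (hx : x ∈ Ω) : 0 < bdryDist Ω x := by
  refine (isClosed_frontier.notMem_iff_infDist_pos hf).1 fun h => ?_
  rw [hΩ.frontier_eq] at h
  exact h.2 hx

/-- Since δ = 0 on ∂Ω, the condition r ≤ δ allows Ω to be replaced by its compact closure. -/
theorem isCompact_inner_parallel {Ω : Set (Eucl N)} (hb : Bornology.IsBounded Ω) {r : ℝ}
    (hr : 0 < r) : IsCompact {x ∈ Ω | r ≤ bdryDist Ω x} := by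
  have h : {x ∈ Ω | r ≤ bdryDist Ω x} = closure Ω ∩ {x | r ≤ bdryDist Ω x} := by
    ext x
    refine ⟨fun hx => ⟨subset_closure hx.1, hx.2⟩, fun hx => ⟨?_, hx.2⟩⟩
    by_contra h0
    have hf : x ∈ frontier Ω := ⟨hx.1, fun h => h0 (interior_subset h)⟩
    have : bdryDist Ω x = 0 := Metric.infDist_zero_of_mem hf
    have : r ≤ bdryDist Ω x := hx.2
    linarith
  rw [h]
  exact hb.isCompact_closure.inter_right (isClosed_le continuous_const (continuous_bdryDist Ω))

theorem isOpen_parallelSet {Ω : Set (Eucl N)} (hΩ : IsOpen Ω) (ρ : ℝ) :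
    IsOpen (parallelSet Ω ρ) :=
  hΩ.inter (isOpen_lt (continuous_bdryDist Ω) continuous_const)

theorem integrable_mul_of_continuousOn {G : Set (Eucl N)} (hG : IsOpen G) {q w : Eucl N → ℝ}
    (hq : ContinuousOn q G) (hw : Continuous w) (hs : HasCompactSupport w)
    (hwG : tsupport w ⊆ G) : Integrable fun x => q x * w x :=
  (integrable_smul_of_tsupport_subset (hq.locallyIntegrableOn hG.measurableSet) hw hs hwG).congr
    (Eventually.of_forall fun _ => mul_comm _ _)

theorem integrable_inner_of_memLp {a b : Eucl N → Eucl N} (ha : MemLp a 2 volume)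
    (hb : MemLp b 2 volume) : Integrable fun x => inner ℝ (a x) (b x) := by
  refine Integrable.mono' (MemLp.integrable_mul (p := 2) (q := 2) ha.norm hb.norm)
    (ha.1.inner hb.1) (Eventually.of_forall fun _ => norm_inner_le_norm _ _)

/-- The supremum is attained: each c < μ lies below an admissible constant, and c ↑ μ passes to the
limit, even when the integral is infinite, since μ > 0 in the remaining case. -/
theorem hardy_lintegral {Ω : Set (Eucl N)} {μ : ℝ} (hμ : μ ≤ hardyConstant Ω)
    {w : Eucl N → ℝ} {g : Eucl N → Eucl N} (hw : MemH10 Ω w g) :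
    ENNReal.ofReal μ * ∫⁻ x in Ω, ENNReal.ofReal (w x ^ 2 / bdryDist Ω x ^ 2)
      ≤ ∫⁻ x in Ω, ENNReal.ofReal (‖g x‖ ^ 2) := by
  have hlt : ∀ c < μ, ENNReal.ofReal c * ∫⁻ x in Ω, ENNReal.ofReal (w x ^ 2 / bdryDist Ω x ^ 2)
      ≤ ∫⁻ x in Ω, ENNReal.ofReal (‖g x‖ ^ 2) := fun c hc => by
    have hcμ := hc.trans_le hμ
    unfold hardyConstant at hcμ
    obtain ⟨c', hc', hcc'⟩ := exists_lt_of_lt_csSup (by exact ⟨0, le_rfl, by simp⟩) hcμ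
    refine le_trans ?_ (hc'.2 w g hw)
    gcongr
  rcases le_or_gt μ 0 with h0 | h0
  · simp [ENNReal.ofReal_of_nonpos h0]
  have hpos : ENNReal.ofReal μ ≠ 0 := (ENNReal.ofReal_pos.2 h0).ne'
  have hlim : Tendsto (fun c => ENNReal.ofReal c *
      ∫⁻ x in Ω, ENNReal.ofReal (w x ^ 2 / bdryDist Ω x ^ 2)) (𝓝[<] μ)
      (𝓝 (ENNReal.ofReal μ * ∫⁻ x in Ω, ENNReal.ofReal (w x ^ 2 / bdryDist Ω x ^ 2))) :=
    ENNReal.Tendsto.mul_const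
      ((ENNReal.continuous_ofReal.tendsto μ).mono_left nhdsWithin_le_nhds) (Or.inl hpos)
  exact le_of_tendsto hlim (eventually_nhdsWithin_of_forall hlt)

/-- Compact support in Ω makes both integrals finite, so for μ > 0 the inequality descends from [0,
∞] to ℝ. For μ ≤ 0 it is a matter of signs. -/
theorem hardy_integral {Ω : Set (Eucl N)} (hΩ : IsOpen Ω) (hδ : ∀ x ∈ Ω, 0 < bdryDist Ω x)
    {μ : ℝ} (hμ : μ ≤ hardyConstant Ω) {w : Eucl N → ℝ} {g : Eucl N → Eucl N}
    (hw : IsCompactSobolev w g) (hwΩ : tsupport w ⊆ Ω) (hg : ∀ x ∉ Ω, g x = 0) :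
    ∫ x, μ / bdryDist Ω x ^ 2 * w x * w x ≤ ∫ x, ‖g x‖ ^ 2 := by
  have hJ : Integrable fun x => ‖g x‖ ^ 2 := hw.memLp.integrable_norm_pow (by norm_num)
  have hI : Integrable fun x => w x ^ 2 / bdryDist Ω x ^ 2 := by
    have hq : ContinuousOn (fun x => w x / bdryDist Ω x ^ 2) Ω :=
      hw.continuous.continuousOn.div ((continuous_bdryDist Ω).continuousOn.pow 2) fun x hx =>
        (pow_pos (hδ x hx) 2).ne'
    refine (integrable_mul_of_continuousOn hΩ hq hw.continuous hw.hasCompactSupport hwΩ).congr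
      (Eventually.of_forall fun x => ?_)
    dsimp only
    ring
  have hw0 : ∀ x ∉ Ω, w x = 0 := fun x hx => image_eq_zero_of_notMem_tsupport fun h => hx (hwΩ h)
  have heq : ∫ x, μ / bdryDist Ω x ^ 2 * w x * w x = μ * ∫ x, w x ^ 2 / bdryDist Ω x ^ 2 := by
    rw [← integral_const_mul]
    exact integral_congr_ae (Eventually.of_forall fun x => by dsimp only; ring)
  have hI0 : 0 ≤ ∫ x, w x ^ 2 / bdryDist Ω x ^ 2 := integral_nonneg fun x => by positivity
  have hJ0 : 0 ≤ ∫ x, ‖g x‖ ^ 2 := integral_nonneg fun x => by positivity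
  rw [heq]
  rcases le_or_gt μ 0 with h0 | h0
  · exact (mul_nonpos_of_nonpos_of_nonneg h0 hI0).trans hJ0
  have h := hardy_lintegral hμ (hw.memH10 hΩ hwΩ)
  rw [← ofReal_integral_eq_lintegral_ofReal hI.restrict
      (Eventually.of_forall fun x => by positivity),
    ← ofReal_integral_eq_lintegral_ofReal hJ.restrict
      (Eventually.of_forall fun x => by positivity), ← ENNReal.ofReal_mul h0.le,
    setIntegral_eq_integral_of_forall_compl_eq_zero fun x hx => by simp [hw0 x hx],
    setIntegral_eq_integral_of_forall_compl_eq_zero fun x hx => by simp [hg x hx]] at h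
  exact (ENNReal.ofReal_le_ofReal_iff hJ0).1 h

/-! ### Cutoffs and the truncation (u - εχH)⁺. -/

/-- A smooth cutoff, equal to one near `∂Ω` and to zero away from it. -/
theorem exists_boundary_cutoff (Ω : Set (Eucl N)) {ρ : ℝ} (hρ : 0 < ρ) :
    ∃ χ : Eucl N → ℝ, ContDiff ℝ ∞ χ ∧ (∀ x, 0 ≤ χ x ∧ χ x ≤ 1) ∧
      (∀ x, bdryDist Ω x ≤ ρ / 3 → χ x = 1) ∧ ∀ x, ρ / 2 ≤ bdryDist Ω x → χ x = 0 := by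
  obtain ⟨χ, h0, h1, h01⟩ := exists_contMDiffMap_zero_one_of_isClosed (n := ⊤)
    (modelWithCornersSelf ℝ (Eucl N))
    (isClosed_le (continuous_const (y := ρ / 2)) (continuous_bdryDist Ω))
    (isClosed_le (continuous_bdryDist Ω) (continuous_const (y := ρ / 3)))
    (Set.disjoint_left.2 fun x (hx : ρ / 2 ≤ _) (hx' : _ ≤ ρ / 3) => by linarith)
  exact ⟨χ, χ.contMDiff.contDiff, h01, fun x hx => h1 hx, fun x hx => h0 hx⟩

/-- Having ζ = 1 on a neighbourhood of each point of K forces ∇ζ = 0 on K, so ζ disappears from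
gradients computed there. -/
theorem exists_test_function_eq_one {G K : Set (Eucl N)} (hG : IsOpen G) (hK : IsCompact K)
    (hKG : K ⊆ G) : ∃ ζ : Eucl N → ℝ, IsTestFunction G ζ ∧ (∀ x, 0 ≤ ζ x) ∧
      ∀ x ∈ K, ∀ᶠ y in 𝓝 x, ζ y = 1 := by
  obtain ⟨L, hL, hKL, hLG⟩ := exists_compact_between hK hG hKG
  obtain ⟨ζ, h0, h1, h01⟩ := exists_contMDiffMap_zero_one_nhds_of_isClosed (n := ⊤)
    (modelWithCornersSelf ℝ (Eucl N)) isOpen_interior.isClosed_compl hK.isClosed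
    (Set.disjoint_left.2 fun x hx hx' => hx (hKL hx'))
  have hts : tsupport ζ ⊆ L := closure_minimal (fun x hx => by
    by_contra h
    exact hx (h0.self_of_nhdsSet x fun h' => h (interior_subset h'))) hL.isClosed
  exact ⟨ζ, ⟨ζ.contMDiff.contDiff, hL.of_isClosed_subset (isClosed_tsupport _) hts,
    hts.trans hLG⟩, fun x => (h01 x).1, fun x hx => eventually_nhdsSet_iff_forall.1 h1 x hx⟩

/-- The positive part of `u - ε χ H` is a compactly supported Sobolev function when `u < ε H` near
the boundary. -/
theorem exists_truncation {Ω : Set (Eucl N)} (hΩ : IsOpen Ω) (hb : Bornology.IsBounded Ω)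
    {ρ ε r : ℝ} (hr : 0 < r) (hrρ : r ≤ ρ / 3)
    {u H χ : Eucl N → ℝ} {gu gH : Eucl N → Eucl N}
    (hu : MemH1loc Ω u gu) (huc : ContinuousOn u Ω)
    (hH : MemH1loc (parallelSet Ω ρ) H gH) (hHc : ContinuousOn H (parallelSet Ω ρ))
    (hdom : ∀ x ∈ Ω, bdryDist Ω x < r → u x < ε * H x)
    (hχ : ContDiff ℝ ∞ χ) (hχ1 : ∀ x, bdryDist Ω x ≤ ρ / 3 → χ x = 1)
    (hχ0 : ∀ x, ρ / 2 ≤ bdryDist Ω x → χ x = 0) :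
    ∃ (w : Eucl N → ℝ) (gw : Eucl N → Eucl N), IsCompactSobolev w gw ∧ tsupport w ⊆ Ω ∧
      (∀ x ∈ Ω, w x = max (u x - ε * (χ x * H x)) 0) ∧
      (∀ x, 0 ≤ w x) ∧ (∀ x, w x = 0 → gw x = 0) ∧
      ∀ x, 0 < w x → gw x = gu x - ε • (χ x • gH x + H x • gradient χ x) := by
  set K : Set (Eucl N) := {x ∈ Ω | r ≤ bdryDist Ω x} with hKdef
  have hK : IsCompact K := isCompact_inner_parallel hb hr
  have hρ : 0 < ρ := by linarith
  -- u and H are only locally Sobolev, so ζ(u - εχH) is truncated instead. Its positive part agrees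
  -- on Ω with that of u - εχH, which is negative in Ω off K.
  obtain ⟨ζ, hζ, hζ0, hζ1⟩ := exists_test_function_eq_one hΩ hK fun x hx => hx.1
  have hχts : tsupport χ ⊆ {x | bdryDist Ω x ≤ ρ / 2} :=
    closure_minimal (fun x hx => by
      by_contra h
      exact hx (hχ0 x (not_le.1 h).le)) (isClosed_le (continuous_bdryDist Ω) continuous_const)
  have hχζ : IsTestFunction (parallelSet Ω ρ) fun x => χ x * ζ x :=
    hζ.mul_left hχ fun x hx => ⟨hx.1, lt_of_le_of_lt (hχts hx.2) (by linarith)⟩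
  have h1 := hu.isCompactSobolev_mul hΩ huc hζ
  have h2 := hH.isCompactSobolev_mul (isOpen_parallelSet hΩ ρ) hHc hχζ
  have h := h1.sub_const_mul h2 ε
  have hfact : ∀ x, ζ x * u x - ε * (χ x * ζ x * H x) = ζ x * (u x - ε * (χ x * H x)) :=
    fun x => by ring
  -- Here r ≤ ρ/3 matters: χ = 1 where δ < r, so the domination u < εH applies to χH.
  have hneg : ∀ x ∈ Ω, x ∉ K → u x - ε * (χ x * H x) < 0 := fun x hx hxK => by
    have hxr : bdryDist Ω x < r := by
      by_contra h'
      exact hxK ⟨hx, not_lt.1 h'⟩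
    rw [hχ1 x (hxr.le.trans hrρ), one_mul]
    linarith [hdom x hx hxr]
  have hposK : ∀ x, 0 < ζ x * u x - ε * (χ x * ζ x * H x) → x ∈ K := fun x hx => by
    rw [hfact] at hx
    have hζx : ζ x ≠ 0 := fun h0 => by simp [h0] at hx
    have hxΩ : x ∈ Ω := hζ.2.2 (subset_tsupport ζ hζx)
    by_contra hxK
    exact (mul_nonpos_of_nonneg_of_nonpos (hζ0 x) (hneg x hxΩ hxK).le).not_gt hx
  refine ⟨_, _, h.posPart, ?_, fun x hx => ?_, fun x => le_max_right _ _, fun x hx => ?_,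
    fun x hx => ?_⟩
  · have : tsupport (fun x => max (ζ x * u x - ε * (χ x * ζ x * H x)) 0) ⊆ K := by
      refine closure_minimal (fun x hx => hposK x ?_) hK.isClosed
      by_contra h'
      exact hx (max_eq_right (not_lt.1 h'))
    exact this.trans fun x hx => hx.1
  · simp only [hfact]
    by_cases hxK : x ∈ K
    · rw [(hζ1 x hxK).self_of_nhds, one_mul]
    · have := hneg x hx hxK
      rw [max_eq_right this.le, max_eq_right (mul_nonpos_of_nonneg_of_nonpos (hζ0 x) this.le)]
  · refine Set.indicator_of_notMem (fun h' => ?_) _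
    exact (show 0 < ζ x * u x - ε * (χ x * ζ x * H x) from h').not_ge (max_eq_right_iff.1 hx)
  · have hx' : 0 < ζ x * u x - ε * (χ x * ζ x * H x) := by
      rcases lt_max_iff.1 hx with h' | h'
      · exact h'
      · exact absurd h' (lt_irrefl _)
    have hxK := hposK x hx'
    have e1 : ζ x = 1 := (hζ1 x hxK).self_of_nhds
    have e2 : gradient ζ x = 0 := by
      rw [Filter.EventuallyEq.gradient_eq (f := fun _ => (1 : ℝ)) (hζ1 x hxK)]
      exact gradient_fun_const x 1
    rw [Set.indicator_of_mem (s := {x | 0 < ζ x * u x - ε * (χ x * ζ x * H x)}) hx',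
      gradient_mul (hχ.differentiable (by simp) x) (hζ.1.differentiable (by simp) x), e1, e2]
    simp

/-! ### The commutator with the cutoff and the energy inequality. -/

/-- By the strict inequalities χ is constant near x. This confines the commutator to the shell ρ/3 ≤
δ ≤ ρ/2. -/
theorem gradient_cutoff_eq_zero {Ω : Set (Eucl N)} {ρ : ℝ} {χ : Eucl N → ℝ}
    (hχ1 : ∀ x, bdryDist Ω x ≤ ρ / 3 → χ x = 1) (hχ0 : ∀ x, ρ / 2 ≤ bdryDist Ω x → χ x = 0)
    {x : Eucl N} (hx : bdryDist Ω x < ρ / 3 ∨ ρ / 2 < bdryDist Ω x) : gradient χ x = 0 := by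
  have hc := (continuous_bdryDist Ω).continuousAt (x := x)
  rcases hx with hx | hx
  · rw [Filter.EventuallyEq.gradient_eq (f := fun _ => (1 : ℝ))
      ((hc.eventually (gt_mem_nhds hx)).mono fun y hy => hχ1 y (le_of_lt hy))]
    exact gradient_fun_const x 1
  · rw [Filter.EventuallyEq.gradient_eq (f := fun _ => (0 : ℝ))
      ((hc.eventually (lt_mem_nhds hx)).mono fun y hy => hχ0 y (le_of_lt hy))]
    exact gradient_fun_const x 0

/-- The commutator of the Dirichlet form with the cutoff `χ`. -/
def commutator (χ H : Eucl N → ℝ) (gH : Eucl N → Eucl N) (w : Eucl N → ℝ)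
    (gw : Eucl N → Eucl N) (x : Eucl N) : ℝ :=
  inner ℝ (H x • gradient χ x) (gw x) - inner ℝ (gH x) (w x • gradient χ x)

/-- An integrable bound for the commutator terms, uniform in `ε ≤ 1`. -/
theorem exists_commutator_bound {Ω : Set (Eucl N)} (hb : Bornology.IsBounded Ω)
    {ρ : ℝ} (hρ : 0 < ρ) {u H χ : Eucl N → ℝ} {gu gH : Eucl N → Eucl N}
    (hu : MemH1loc Ω u gu) (hu0 : ∀ x ∈ Ω, 0 ≤ u x)
    (hH : MemH1loc (parallelSet Ω ρ) H gH) (hHpos : ∀ x ∈ parallelSet Ω ρ, 0 < H x)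
    (hχ : ContDiff ℝ ∞ χ) (hχ01 : ∀ x, 0 ≤ χ x ∧ χ x ≤ 1)
    (hχ1 : ∀ x, bdryDist Ω x ≤ ρ / 3 → χ x = 1) (hχ0 : ∀ x, ρ / 2 ≤ bdryDist Ω x → χ x = 0) :
    ∃ D : Eucl N → ℝ, Integrable D ∧ ∀ (ε : ℝ) (w : Eucl N → ℝ) (gw : Eucl N → Eucl N),
      0 < ε → ε ≤ 1 → (∀ x ∈ Ω, w x = max (u x - ε * (χ x * H x)) 0) →
      (∀ x ∉ Ω, w x = 0) → (∀ x, w x = 0 → gw x = 0) →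
      (∀ x, 0 < w x → gw x = gu x - ε • (χ x • gH x + H x • gradient χ x)) →
      ∀ x, |commutator χ H gH w gw x| ≤ D x := by
  -- The shell is a compact subset of both Ω and Ω_ρ, so local L² bounds suffice and nothing is
  -- asked of u or H near ∂Ω.
  set K : Set (Eucl N) := {x ∈ Ω | ρ / 3 ≤ bdryDist Ω x} ∩ {x | bdryDist Ω x ≤ ρ / 2} with hKdef
  have hK : IsCompact K := (isCompact_inner_parallel hb (by positivity)).inter_right
    (isClosed_le (continuous_bdryDist Ω) continuous_const)
  have hKΩ : K ⊆ Ω := fun x hx => hx.1.1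
  have hKρ : K ⊆ parallelSet Ω ρ := fun x hx =>
    ⟨hx.1.1, lt_of_le_of_lt hx.2 (by linarith)⟩
  obtain ⟨M, hM⟩ := hK.exists_bound_of_continuousOn (continuous_gradient hχ).continuousOn
  obtain ⟨mu, mgu⟩ := hu.2 K hK hKΩ
  obtain ⟨mH, mgH⟩ := hH.2 K hK hKρ
  set b : Eucl N → ℝ := fun x => M * H x
  have mb : MemLp b 2 (volume.restrict K) := mH.const_mul M
  have i1 := MemLp.integrable_mul (p := 2) (q := 2) mb ((mgu.norm.add mgH.norm).add mb)
  have i2 := (MemLp.integrable_mul (p := 2) (q := 2) mu mgH.norm).const_mul M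
  refine ⟨K.indicator fun x => b x * (‖gu x‖ + ‖gH x‖ + b x) + M * (u x * ‖gH x‖),
    (integrable_indicator_iff hK.measurableSet).2 (i1.add i2), ?_⟩
  intro ε w gw hε0 hε1 hw hwΩ hgw0 hgw x
  by_cases hxK : x ∈ K
  · rw [Set.indicator_of_mem hxK]
    have hxΩ := hKΩ hxK
    have hHx : 0 < H x := hHpos x (hKρ hxK)
    have hM0 : 0 ≤ M := (norm_nonneg _).trans (hM x hxK)
    have hux := hu0 x hxΩ
    have hb0 : 0 ≤ b x := mul_nonneg hM0 hHx.le
    have hw0 : 0 ≤ w x := by rw [hw x hxΩ]; exact le_max_right _ _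
    -- With 0 ≤ w ≤ u, and with ε ≤ 1 and χ ≤ 1 in the bound for gw below, no estimate depends on ε.
    have hwu : w x ≤ u x := by
      rw [hw x hxΩ]
      exact max_le (sub_le_self _ (mul_nonneg hε0.le (mul_nonneg (hχ01 x).1 hHx.le))) hux
    rcases hw0.eq_or_lt with hwx | hwx
    · rw [commutator, hgw0 x hwx.symm, ← hwx, zero_smul, inner_zero_right, inner_zero_right,
        sub_zero, abs_zero]
      positivity
    · have hHg : ‖H x • gradient χ x‖ ≤ b x := by
        rw [norm_smul, Real.norm_of_nonneg hHx.le, mul_comm]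
        exact mul_le_mul_of_nonneg_right (hM x hxK) hHx.le
      have hgwx : ‖gw x‖ ≤ ‖gu x‖ + ‖gH x‖ + b x := by
        rw [hgw x hwx, add_assoc]
        refine (norm_sub_le _ _).trans (add_le_add le_rfl ?_)
        rw [norm_smul, Real.norm_of_nonneg hε0.le]
        refine (mul_le_of_le_one_left (norm_nonneg _) hε1).trans
          ((norm_add_le _ _).trans (add_le_add ?_ hHg))
        rw [norm_smul, Real.norm_of_nonneg (hχ01 x).1]
        exact mul_le_of_le_one_left (norm_nonneg _) (hχ01 x).2
      have hwg : ‖w x • gradient χ x‖ ≤ M * u x := by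
        rw [norm_smul, Real.norm_of_nonneg hw0, mul_comm]
        exact mul_le_mul (hM x hxK) hwu hw0 hM0
      calc |commutator χ H gH w gw x| ≤ |inner ℝ (H x • gradient χ x) (gw x)|
            + |inner ℝ (gH x) (w x • gradient χ x)| := abs_sub _ _
        _ ≤ ‖H x • gradient χ x‖ * ‖gw x‖ + ‖gH x‖ * ‖w x • gradient χ x‖ :=
            add_le_add (abs_real_inner_le_norm _ _) (abs_real_inner_le_norm _ _)
        _ ≤ b x * (‖gu x‖ + ‖gH x‖ + b x) + ‖gH x‖ * (M * u x) := by gcongr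
        _ = _ := by ring
  · rw [Set.indicator_of_notMem hxK]
    have hzero : gradient χ x = 0 ∨ (w x = 0 ∧ gw x = 0) := by
      by_cases hxΩ : x ∈ Ω
      · refine Or.inl (gradient_cutoff_eq_zero hχ1 hχ0 ?_)
        by_contra! h
        exact hxK ⟨⟨hxΩ, h.1⟩, h.2⟩
      · exact Or.inr ⟨hwΩ x hxΩ, hgw0 x (hwΩ x hxΩ)⟩
    rcases hzero with h | ⟨h1, h2⟩
    · simp [commutator, h]
    · simp [commutator, h1, h2]

/-- The energy inequality obtained by testing the equation with `(u - ε χ H)⁺`. -/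
theorem integral_mul_truncation_le {Ω : Set (Eucl N)} (hΩ : IsOpen Ω)
    (hδ : ∀ x ∈ Ω, 0 < bdryDist Ω x) {μ : ℝ} (hμ : μ ≤ hardyConstant Ω) {ρ ε : ℝ} (hρ : 0 < ρ)
    (hε : 0 < ε) {u H χ P w D : Eucl N → ℝ} {gu gH gw : Eucl N → Eucl N}
    (hsub : ∀ (φ : Eucl N → ℝ) (ψ : Eucl N → Eucl N), MemH1c Ω φ ψ →
      (∀ᵐ x ∂(volume.restrict Ω), 0 ≤ φ x) →
        linearForm Ω μ Ω u gu φ ψ + ∫ x in Ω, P x * φ x ≤ 0)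
    (hH : MemH1loc (parallelSet Ω ρ) H gH) (hHc : ContinuousOn H (parallelSet Ω ρ))
    (hsup : ∀ (φ : Eucl N → ℝ) (ψ : Eucl N → Eucl N), MemH1c (parallelSet Ω ρ) φ ψ →
      (∀ᵐ x ∂(volume.restrict (parallelSet Ω ρ)), 0 ≤ φ x) →
        0 ≤ linearForm Ω μ (parallelSet Ω ρ) H gH φ ψ)
    (hχ : ContDiff ℝ ∞ χ) (hχ01 : ∀ x, 0 ≤ χ x ∧ χ x ≤ 1)
    (hχ0 : ∀ x, ρ / 2 ≤ bdryDist Ω x → χ x = 0)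
    (hw : IsCompactSobolev w gw) (hwΩ : tsupport w ⊆ Ω)
    (hwdef : ∀ x ∈ Ω, w x = max (u x - ε * (χ x * H x)) 0) (hw0 : ∀ x, 0 ≤ w x)
    (hgw0 : ∀ x, w x = 0 → gw x = 0)
    (hgw : ∀ x, 0 < w x → gw x = gu x - ε • (χ x • gH x + H x • gradient χ x))
    (hD : Integrable D) (hDle : ∀ x, |commutator χ H gH w gw x| ≤ D x) :
    ∫ x in Ω, P x * w x ≤ ε * ∫ x, D x := by
  have hwz : ∀ x ∉ Ω, w x = 0 := fun x hx =>
    image_eq_zero_of_notMem_tsupport fun h => hx (hwΩ h)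
  have hgwz : ∀ x ∉ Ω, gw x = 0 := fun x hx => hgw0 x (hwz x hx)
  have hgwts : ∀ x, x ∉ tsupport w → gw x = 0 := fun x hx =>
    hgw0 x (image_eq_zero_of_notMem_tsupport hx)
  have hχts : tsupport χ ⊆ {x | bdryDist Ω x ≤ ρ / 2} :=
    closure_minimal (fun x hx => by
      by_contra h
      exact hx (hχ0 x (not_le.1 h).le)) (isClosed_le (continuous_bdryDist Ω) continuous_const)
  have hlt : ρ / 2 < ρ := by linarith
  set ψ : Eucl N → Eucl N := fun x => χ x • gw x + w x • gradient χ x with hψdef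
  have hχw : IsCompactSobolev (fun x => χ x * w x) ψ := hw.smooth_mul hχ hgwts
  have hχwts : tsupport (fun x => χ x * w x) ⊆ parallelSet Ω ρ := fun x hx =>
    ⟨hwΩ (tsupport_mul_subset_inter _ _ hx).2,
      lt_of_le_of_lt (hχts (tsupport_mul_subset_inter _ _ hx).1) hlt⟩
  -- the compact set carrying the integrals that involve `H`
  set K : Set (Eucl N) := tsupport w ∩ {x | bdryDist Ω x ≤ ρ / 2}
  have hK : IsCompact K := hw.hasCompactSupport.isCompact.inter_right
    (isClosed_le (continuous_bdryDist Ω) continuous_const)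
  have hKρ : K ⊆ parallelSet Ω ρ := fun x hx => ⟨hwΩ hx.1, lt_of_le_of_lt hx.2 hlt⟩
  obtain ⟨mH, mgH⟩ := hH.2 K hK hKρ
  have hχK : ∀ x, x ∉ K → (w x = 0 ∧ gw x = 0) ∨ (χ x = 0 ∧ gradient χ x = 0) := fun x hx => by
    by_cases hxw : x ∈ tsupport w
    · have hx' : x ∉ tsupport χ := fun h => hx ⟨hxw, hχts h⟩
      exact Or.inr ⟨image_eq_zero_of_notMem_tsupport hx', gradient_eq_zero_of_notMem_tsupport hx'⟩
    · exact Or.inl ⟨image_eq_zero_of_notMem_tsupport hxw, hgwts x hxw⟩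
  -- H and its gradient are square integrable only on compact subsets of Ω_ρ. Restricting to K
  -- changes none of the products, because the other factor vanishes off K.
  have mgH' : MemLp (K.indicator gH) 2 volume :=
    (memLp_indicator_iff_restrict hK.measurableSet).2 mgH
  have mHχ' : MemLp (K.indicator fun x => H x • gradient χ x) 2 volume := by
    rw [memLp_indicator_iff_restrict hK.measurableSet]
    obtain ⟨M, hM⟩ := hK.exists_bound_of_continuousOn (continuous_gradient hχ).continuousOn
    refine mH.of_le_mul (c := M)
      (mH.1.smul (continuous_gradient hχ).aestronglyMeasurable) ?_
    refine (ae_restrict_iff' hK.measurableSet).2 (Eventually.of_forall fun x hx => ?_)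
    rw [norm_smul, mul_comm]
    gcongr
    exact hM x hx
  have mwχ : MemLp (fun x => w x • gradient χ x) 2 volume :=
    (hw.continuous.smul (continuous_gradient hχ)).memLp_of_hasCompactSupport
      (hw.hasCompactSupport.smul_right (f' := gradient χ))
  have iT : Integrable (commutator χ H gH w gw) := by
    refine ((integrable_inner_of_memLp mHχ' hw.memLp).sub
      (integrable_inner_of_memLp mgH' mwχ)).congr (Eventually.of_forall fun x => ?_)
    by_cases hx : x ∈ K
    · simp [commutator, hx]
    · rcases hχK x hx with ⟨h1, h2⟩ | ⟨h1, h2⟩ <;> simp [commutator, Set.indicator, h1, h2]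
  have iC : Integrable fun x => inner ℝ (gH x) (ψ x) := by
    refine (integrable_inner_of_memLp mgH' hχw.memLp).congr (Eventually.of_forall fun x => ?_)
    by_cases hx : x ∈ K
    · simp [hx]
    · rcases hχK x hx with ⟨h1, h2⟩ | ⟨h1, h2⟩ <;> simp [hψdef, h1, h2]
  have iJ : Integrable fun x => ‖gw x‖ ^ 2 := hw.memLp.integrable_norm_pow (by norm_num)
  have hpot : ∀ x ∈ Ω, bdryDist Ω x ^ 2 ≠ 0 := fun x hx => (pow_pos (hδ x hx) 2).ne'
  have hpc : ContinuousOn (fun x => μ / bdryDist Ω x ^ 2) Ω :=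
    continuousOn_const.div ((continuous_bdryDist Ω).continuousOn.pow 2) hpot
  have iB : Integrable fun x => μ / bdryDist Ω x ^ 2 * w x * w x :=
    integrable_mul_of_continuousOn hΩ (hpc.mul hw.continuous.continuousOn) hw.continuous
      hw.hasCompactSupport hwΩ
  have iE : Integrable fun x => μ / bdryDist Ω x ^ 2 * H x * (χ x * w x) :=
    integrable_mul_of_continuousOn (isOpen_parallelSet hΩ ρ)
      ((hpc.mono fun x hx => hx.1).mul hHc) hχw.continuous hχw.hasCompactSupport hχwts
  -- The inequality for H is tested with χw rather than w, which need not be supported in Ω_ρ.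
  have hsup' := hsup _ _ (hχw.memH1c hχwts)
    (Eventually.of_forall fun x => mul_nonneg (hχ01 x).1 (hw0 x))
  have hsub' := hsub _ _ (hw.memH1c hwΩ) (Eventually.of_forall hw0)
  have hχwz : ∀ x ∉ parallelSet Ω ρ, χ x * w x = 0 ∧ ψ x = 0 := fun x hx => by
    rcases hχK x fun h => hx (hKρ h) with ⟨h1, h2⟩ | ⟨h1, h2⟩ <;> simp [hψdef, h1, h2]
  rw [linearForm,
    setIntegral_eq_integral_of_forall_compl_eq_zero fun x hx => by rw [(hχwz x hx).2, inner_zero_right],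
    setIntegral_eq_integral_of_forall_compl_eq_zero fun x hx => by rw [(hχwz x hx).1, mul_zero]]
    at hsup'
  rw [linearForm,
    setIntegral_eq_integral_of_forall_compl_eq_zero
      (f := fun x => inner ℝ (gu x) (gw x)) fun x hx => by rw [hgwz x hx, inner_zero_right],
    setIntegral_eq_integral_of_forall_compl_eq_zero
      (f := fun x => μ / bdryDist Ω x ^ 2 * u x * w x) fun x hx => by rw [hwz x hx, mul_zero]]
    at hsub'
  have hhardy := hardy_integral hΩ hδ hμ hw hwΩ hgwz
  -- On {w > 0}, ∇u = ∇w + ε∇(χH) and ∇(χH)·∇w = ∇H·∇(χw) + T. Where w = 0 every term vanishes.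
  have eA : ∫ x, inner ℝ (gu x) (gw x) = (∫ x, ‖gw x‖ ^ 2)
      + ε * (∫ x, inner ℝ (gH x) (ψ x)) + ε * ∫ x, commutator χ H gH w gw x := by
    have iJC : Integrable fun x => ‖gw x‖ ^ 2 + ε * inner ℝ (gH x) (ψ x) := iJ.add (iC.const_mul ε)
    rw [← integral_const_mul, ← integral_const_mul, ← integral_add iJ (iC.const_mul ε),
      ← integral_add iJC (iT.const_mul ε)]
    refine integral_congr_ae (Eventually.of_forall fun x => ?_)
    rcases (hw0 x).eq_or_lt with hx | hx
    · have := hgw0 x hx.symm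
      simp [commutator, hψdef, this, ← hx]
    · have hgu : gu x = gw x + ε • (χ x • gH x + H x • gradient χ x) := by
        rw [hgw x hx]; abel
      simp only [commutator, hψdef]
      rw [hgu]
      simp only [inner_add_left, inner_add_right, real_inner_smul_left, real_inner_smul_right,
        real_inner_self_eq_norm_sq]
      ring
  have eB : ∫ x, μ / bdryDist Ω x ^ 2 * u x * w x = (∫ x, μ / bdryDist Ω x ^ 2 * w x * w x)
      + ε * ∫ x, μ / bdryDist Ω x ^ 2 * H x * (χ x * w x) := by
    rw [← integral_const_mul, ← integral_add iB (iE.const_mul ε)]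
    refine integral_congr_ae (Eventually.of_forall fun x => ?_)
    rcases (hw0 x).eq_or_lt with hx | hx
    · simp [← hx]
    · have hxΩ : x ∈ Ω := by
        by_contra h
        exact hx.ne' (hwz x h)
      have hux : u x = w x + ε * (χ x * H x) := by
        have h1 := hwdef x hxΩ
        rcases max_cases (u x - ε * (χ x * H x)) 0 with ⟨h2, -⟩ | ⟨h2, -⟩
        · rw [h1, h2]; ring
        · rw [h1, h2] at hx; exact absurd hx (lt_irrefl _)
      dsimp only
      rw [hux]
      ring
  have hTD : -∫ x, commutator χ H gH w gw x ≤ ∫ x, D x := by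
    rw [← integral_neg]
    exact integral_mono iT.neg hD fun x => (neg_le_abs _).trans (hDle x)
  -- Hardy discards the terms quadratic in w and super-harmonicity those pairing H with χw, leaving
  -- only the commutator.
  rw [eA, eB] at hsub'
  have h1 := mul_le_mul_of_nonneg_left hTD hε.le
  have h2 := mul_nonneg hε.le hsup'
  linarith

/-! ### Boundary comparison and the limit ε → 0. -/

theorem exists_lt_mul_of_limsup_nonpos {Ω : Set (Eucl N)} (hδ : ∀ x ∈ Ω, 0 < bdryDist Ω x)
    {u H : Eucl N → ℝ} {ρ : ℝ} (hρ : 0 < ρ) (hHpos : ∀ x ∈ parallelSet Ω ρ, 0 < H x)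
    (hlim : limsup (fun x => ((u x / H x : ℝ) : EReal)) (toBoundary Ω) ≤ 0) {ε : ℝ} (hε : 0 < ε) :
    ∃ r, 0 < r ∧ r ≤ ρ / 3 ∧ ∀ x ∈ Ω, bdryDist Ω x < r → u x < ε * H x := by
  have h : ∀ᶠ x in toBoundary Ω, ((u x / H x : ℝ) : EReal) < (ε : EReal) :=
    eventually_lt_of_limsup_lt (hlim.trans_lt (by exact_mod_cast hε))
  rw [toBoundary, eventually_inf_principal] at h
  obtain ⟨s, hs, hs'⟩ := eventually_comap.1 h |> Metric.eventually_nhds_iff.1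
  -- The cap ρ/3 keeps x in Ω_ρ, where H > 0 permits clearing the denominator, and in the region
  -- where χ = 1.
  refine ⟨min s (ρ / 3), by positivity, min_le_right _ _, fun x hx hxr => ?_⟩
  have h1 := hs' (y := bdryDist Ω x) (by
    rw [Real.dist_0_eq_abs, abs_of_pos (hδ x hx)]
    exact hxr.trans_le (min_le_left _ _)) x rfl hx
  have hHx : 0 < H x := hHpos x ⟨hx, by linarith [hxr.trans_le (min_le_right s (ρ / 3))]⟩
  exact (div_lt_iff₀ hHx).1 (by exact_mod_cast h1)

/-- A subsolution which is dominated at the boundary by a positive local super-harmonic vanishes,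
when `μ` does not exceed the Hardy constant. -/
theorem eq_zero_of_isSubsolution {Ω : Set (Eucl N)} (hΩ : IsOpen Ω) (hb : Bornology.IsBounded Ω)
    (hδ : ∀ x ∈ Ω, 0 < bdryDist Ω x) {μ p s : ℝ} (hμ : μ ≤ hardyConstant Ω) (hp : 0 < p)
    {u H : Eucl N → ℝ} (hu : IsSubsolution Ω μ p s Ω u) (hH : IsPosLocalSuperharmonic Ω μ H)
    (hlim : limsup (fun x => ((u x / H x : ℝ) : EReal)) (toBoundary Ω) ≤ 0) :
    ∀ x ∈ Ω, u x = 0 := by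
  obtain ⟨huc, hu0, gu, hu1, hsub⟩ := hu
  obtain ⟨ρ, hρ, ⟨hHc, gH, hH1, hsup⟩, hHpos⟩ := hH
  obtain ⟨χ, hχ, hχ01, hχ1, hχ0⟩ := exists_boundary_cutoff Ω hρ
  obtain ⟨D, hD, hDle⟩ := exists_commutator_bound hb hρ hu1 hu0 hH1 hHpos hχ hχ01 hχ1 hχ0
  set P : Eucl N → ℝ := fun x => u x ^ p / bdryDist Ω x ^ s with hPdef
  have hPc : ContinuousOn P Ω :=
    (huc.rpow_const fun x _ => Or.inr hp.le).div
      ((continuous_bdryDist Ω).continuousOn.rpow_const fun x hx => Or.inl (hδ x hx).ne')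
      fun x hx => (Real.rpow_pos_of_pos (hδ x hx) s).ne'
  have hP0 : ∀ x ∈ Ω, 0 ≤ P x := fun x hx =>
    div_nonneg (Real.rpow_nonneg (hu0 x hx) p) (Real.rpow_nonneg (hδ x hx).le s)
  have key : ∀ ε : ℝ, 0 < ε → ε ≤ 1 → ∃ w : Eucl N → ℝ, (∀ x, 0 ≤ w x) ∧
      (∀ x ∈ Ω, w x = max (u x - ε * (χ x * H x)) 0) ∧
      IntegrableOn (fun x => P x * w x) Ω ∧ ∫ x in Ω, P x * w x ≤ ε * ∫ x, D x := by
    intro ε hε hε1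
    obtain ⟨r, hr, hrρ, hdom⟩ := exists_lt_mul_of_limsup_nonpos hδ hρ hHpos hlim hε
    obtain ⟨w, gw, hw, hwΩ, hwdef, hw0, hgw0, hgw⟩ :=
      exists_truncation hΩ hb hr hrρ hu1 huc hH1 hHc hdom hχ hχ1 hχ0
    have hwz : ∀ x ∉ Ω, w x = 0 := fun x hx =>
      image_eq_zero_of_notMem_tsupport fun h => hx (hwΩ h)
    exact ⟨w, hw0, hwdef, (integrable_mul_of_continuousOn hΩ hPc hw.continuous
      hw.hasCompactSupport hwΩ).integrableOn,
      integral_mul_truncation_le hΩ hδ hμ hρ hε hsub hH1 hHc hsup hχ hχ01 hχ0 hw hwΩ hwdef hw0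
        hgw0 hgw hD (hDle ε w gw hε hε1 hwdef hwz hgw0 hgw)⟩
  intro x₀ hx₀
  by_contra hne
  have hpos : 0 < u x₀ := lt_of_le_of_ne (hu0 x₀ hx₀) (Ne.symm hne)
  set a := u x₀ / 2 with ha
  have ha0 : 0 < a := half_pos hpos
  -- H is arbitrary outside Ω_ρ, but there χ vanishes on a neighbourhood of x₀.
  have hχH : ContinuousAt (fun x => χ x * H x) x₀ := by
    rcases lt_or_ge (bdryDist Ω x₀) ρ with h | h
    · exact hχ.continuous.continuousAt.mul
        (hHc.continuousAt ((isOpen_parallelSet hΩ ρ).mem_nhds ⟨hx₀, h⟩))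
    · refine (continuousAt_const (y := (0 : ℝ))).congr ?_
      have h' : ρ / 2 < bdryDist Ω x₀ := by linarith
      filter_upwards [(continuous_bdryDist Ω).continuousAt.eventually (lt_mem_nhds h')] with y hy
      rw [hχ0 y (le_of_lt hy), zero_mul]
  set M := |χ x₀ * H x₀| + 1 with hMdef
  have hM0 : 0 < M := by positivity
  have hev : ∀ᶠ x in 𝓝 x₀, x ∈ Ω ∧ a < u x ∧ χ x * H x < M :=
    (hΩ.eventually_mem hx₀).and (((huc.continuousAt (hΩ.mem_nhds hx₀)).eventually
      (lt_mem_nhds (half_lt_self hpos))).and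
      (hχH.eventually (gt_mem_nhds ((le_abs_self _).trans_lt (lt_add_one _)))))
  obtain ⟨R, hR, hRB⟩ := Metric.nhds_basis_closedBall.eventually_iff.1 hev
  set B := Metric.closedBall x₀ R
  have hB : IsCompact B := isCompact_closedBall x₀ R
  have hBΩ : B ⊆ Ω := fun x hx => (hRB hx).1
  have hPB : IntegrableOn P B := (hPc.mono hBΩ).integrableOn_compact hB
  have hPpos : ∀ x ∈ B, 0 < P x := fun x hx =>
    div_pos (Real.rpow_pos_of_pos (ha0.trans (hRB hx).2.1) p)
      (Real.rpow_pos_of_pos (hδ x (hBΩ hx)) s)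
  have hc : 0 < ∫ x in B, P x := by
    refine (setIntegral_pos_iff_support_of_nonneg_ae
      ((ae_restrict_iff' hB.measurableSet).2 (Eventually.of_forall fun x hx => (hPpos x hx).le))
      hPB).2 ?_
    rw [Set.inter_eq_right.2 (show B ⊆ Function.support P from fun x hx => (hPpos x hx).ne')]
    exact Metric.measure_closedBall_pos volume x₀ hR
  set c := ∫ x in B, P x with hcdef
  -- On B, u > a and χH < M, so ε ≤ a/(2M) gives w ≥ a - a/2 = a/2. The left side is then a positive
  -- bound independent of ε.
  have hbound : ∀ ε : ℝ, 0 < ε → ε ≤ 1 → ε ≤ a / 2 / M → c * (a / 2) ≤ ε * ∫ x, D x := by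
    intro ε hε hε1 hεM
    obtain ⟨w, hw0, hwdef, hint, hle⟩ := key ε hε hε1
    refine le_trans ?_ hle
    calc c * (a / 2) = ∫ x in B, P x * (a / 2) := (integral_mul_const _ _).symm
      _ ≤ ∫ x in B, P x * w x := by
          refine setIntegral_mono_on (hPB.mul_const _) (hint.mono_set hBΩ) hB.measurableSet
            fun x hx => mul_le_mul_of_nonneg_left ?_ (hPpos x hx).le
          obtain ⟨hxΩ, hxa, hxM⟩ := hRB hx
          rw [hwdef x hxΩ]
          refine le_max_of_le_left ?_
          have h1 : ε * (χ x * H x) ≤ ε * M := mul_le_mul_of_nonneg_left hxM.le hε.le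
          have h2 : ε * M ≤ a / 2 := (le_div_iff₀ hM0).1 hεM
          linarith
      _ ≤ ∫ x in Ω, P x * w x := setIntegral_mono_set hint
          ((ae_restrict_iff' hΩ.measurableSet).2 (Eventually.of_forall fun x hx =>
            mul_nonneg (hP0 x hx) (hw0 x))) hBΩ.eventuallyLE
  have hlim0 : Tendsto (fun ε : ℝ => ε * ∫ x, D x) (𝓝[>] 0) (𝓝 0) := by
    have : Continuous fun ε : ℝ => ε * ∫ x, D x := by fun_prop
    simpa using (this.tendsto 0).mono_left nhdsWithin_le_nhds
  have hle0 : c * (a / 2) ≤ 0 := by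
    refine ge_of_tendsto hlim0 ?_
    have h1 : ∀ᶠ ε : ℝ in 𝓝[>] 0, ε < min 1 (a / 2 / M) :=
      nhdsWithin_le_nhds (gt_mem_nhds (lt_min one_pos (by positivity)))
    filter_upwards [h1, self_mem_nhdsWithin] with ε hε hε0
    exact hbound ε hε0 (hε.le.trans (min_le_left _ _)) (hε.le.trans (min_le_right _ _))
  exact hle0.not_gt (by positivity)

end HardyNonlinear

end

theorem theorem5p1 (N : ℕ) (hN : 2 ≤ N) (Ω : Set (HardyNonlinear.Eucl N))
    (hΩ_open : IsOpen Ω) (hΩ_conn : IsConnected Ω) (hΩ_bdd : Bornology.IsBounded Ω)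
    (hΩ_C2 : HardyNonlinear.HasBoundaryOfClass 2 Ω)
    (μ p s : ℝ) (hμ : μ ≤ HardyNonlinear.hardyConstant Ω) (hp : 1 < p) :
    ¬ ∃ u : HardyNonlinear.Eucl N → ℝ,
        HardyNonlinear.IsSSubsolution Ω μ p s u ∧ ∃ x ∈ Ω, u x ≠ 0 := by
  rintro ⟨u, ⟨hu, hloc, hsmall⟩, x, hx, hne⟩
  -- u is a local sub-harmonic, so it can fail to be large only through some H with nonpositive
  -- upper limit.
  have hex : ∃ H, HardyNonlinear.IsPosLocalSuperharmonic Ω μ H ∧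
      limsup (fun x => ((u x / H x : ℝ) : EReal)) (HardyNonlinear.toBoundary Ω) ≤ 0 := by
    by_contra! h
    exact hsmall ⟨hloc, h⟩
  obtain ⟨H, hH, hlim⟩ := hex
  have hfr := HardyNonlinear.frontier_nonempty_of_isBounded (by omega) hΩ_conn.nonempty hΩ_bdd
  exact hne (HardyNonlinear.eq_zero_of_isSubsolution hΩ_open hΩ_bdd
    (fun y hy => HardyNonlinear.bdryDist_pos hΩ_open hfr hy) hμ (by linarith) hu hH hlim x hx)
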